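/- Let $p>1$, $f,g,\rho\in C[0,1]$ and $d\in C^1(0,1)$ satisfy $$\rho>0\ \text{in }(0,1),\quad \rho(0)=\rho(1)=0,\qquad g(0)>0,\quad \int_0^u g(s)\,ds>0\ \text{ for every }u\in(0,1],\qquad d>0\ \text{in }(0,1),\quad \rho\, d^{\frac1{p-1}}\in L^1(0,1).$$ A travelling wave solution with speed $c\in\mathbb R$ of the equation $f(u)u_x+g(u)u_\tau=[d(u)|u_x|^{p-2}u_x]_x+\rho(u)$ is a function $u\in C^1(\alpha,\beta)$ on an open interval $(\alpha,\beta)$, $-\infty\le\alpha<\beta\le+\infty$, with $0<u<1$ and $d(u)|u'|^{p-2}u'\in C^1(\alpha,\beta)$ (this product is read as $0$ where $u'=0$), such that $$(d(u)|u'|^{p-2}u')'+(c\,g(u)-f(u))u'+\rho(u)=0\ \text{ in }(\alpha,\beta),$$ $u(\alpha^+)=1$, $u(\beta^-)=0$, and $d(u)|u'|^{p-2}u'\to 0$ as $t\to\alpha^+$ and as $t\to\beta^-$. Assume that the limit $$\ell_0:=\lim_{u\to0^+}\rho(u)\,\frac{d(u)^{\frac1{p-1}}}{u^{\frac1{p-1}}}$$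 exists and is finite, and let $c^*$ be the infimum of the speeds $c$ for which a travelling wave solution exists. Then $c^*$ is a real number, a travelling wave solution with speed $c$ exists if and only if $c\ge c^*$, and for every $k\in\mathbb R$ the following hold. (a) If $f(u)\ge k\,g(u)$ in a right neighbourhood of $0$, then $c^*>k$. (b) If for every $u\in(0,1)$ we have $k\,g(u)\ge f(u)$ and $$(k\,g(u)-f(u))^{p-1}\int_0^u (k\,g(s)-f(s))\,ds\ \ge\ \frac{p^p}{(p-1)^{p-1}}\,d(u)\,\rho(u)^{p-1},$$ then $c^*\le k$. (c) If there are $\delta\in(0,1]$ and $\ell<\frac{p^p}{(p-1)^{p-1}}$ such that for every $u\in(0,\delta)$ we have $k\,g(u)\ge f(u)$ and $$(k\,g(u)-f(u))^{p-1}\int_0^u (k\,g(s)-f(s))\,ds\ \le\ \ell\, d(u)\,\rho(u)^{p-1},$$ then $c^*>k$. -/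

import Mathlib

open Set Filter Topology MeasureTheory

/-- The flux `d(u) |u'|^(p-2) u'` of a profile `u`. -/
noncomputable def flux (p : ℝ) (d : ℝ → ℝ) (u : ℝ → ℝ) (t : ℝ) : ℝ :=
  d (u t) * |deriv u t| ^ (p - 2) * deriv u t

/-- The open interval `(α, β) ⊆ ℝ`, whose endpoints may be infinite. -/
def openInterval (α β : EReal) : Set ℝ := {t : ℝ | α < (t : EReal) ∧ (t : EReal) < β}

/-- The filter of real `t → α⁺`, where `α` may be `-∞`. -/
noncomputable def rightOf (α : EReal) : Filter ℝ := comap (fun t : ℝ => (t : EReal)) (𝓝[>] α)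

/-- The filter of real `t → β⁻`, where `β` may be `+∞`. -/
noncomputable def leftOf (β : EReal) : Filter ℝ := comap (fun t : ℝ => (t : EReal)) (𝓝[<] β)

/-- `u`, restricted to `(α, β)`, is a travelling wave solution with speed `c` of
`f(u) u_x + g(u) u_τ = [d(u) |u_x|^(p-2) u_x]_x + ρ(u)`, connecting `1` to `0`. -/
structure IsTravellingWave (p : ℝ) (f g d ρ : ℝ → ℝ) (c : ℝ) (α β : EReal) (u : ℝ → ℝ) :
    Prop where
  lt : α < β
  contDiffOn : ContDiffOn ℝ 1 u (openInterval α β)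
  mem_Ioo : ∀ t ∈ openInterval α β, u t ∈ Ioo (0 : ℝ) 1
  contDiffOn_flux : ContDiffOn ℝ 1 (flux p d u) (openInterval α β)
  equation : ∀ t ∈ openInterval α β,
    deriv (flux p d u) t + (c * g (u t) - f (u t)) * deriv u t + ρ (u t) = 0
  tendsto_left : Tendsto u (rightOf α) (𝓝 1)
  tendsto_right : Tendsto u (leftOf β) (𝓝 0)
  flux_left : Tendsto (flux p d u) (rightOf α) (𝓝 0)
  flux_right : Tendsto (flux p d u) (leftOf β) (𝓝 0)

/-- The wave speed `c` is admissible: there is a travelling wave solution with speed `c`. -/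
def AdmissibleSpeed (p : ℝ) (f g d ρ : ℝ → ℝ) (c : ℝ) : Prop :=
  ∃ (α β : EReal) (u : ℝ → ℝ), IsTravellingWave p f g d ρ c α β u

/-- The threshold wave speed `c*`, the smallest admissible one. -/
noncomputable def thresholdSpeed (p : ℝ) (f g d ρ : ℝ → ℝ) : ℝ :=
  sInf {c : ℝ | AdmissibleSpeed p f g d ρ c}

/-! Write `r = 1/(p-1)`, `h = c g - f`, `q = ρ d^r`. The flux of a wave is negative, so `u`
decreases strictly and minus the flux can be read as a function `w` of the value `x = u`. It
satisfies the singular first-order equation `w' = h - q w^(-r)` on `(0,1)`, with `w > 0` and `w → 0`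
at both ends. Conversely, such a `w` determines `u` by integrating `u' = -(w/d)^r`. Admissibility of
`c` thus becomes solvability of this boundary value problem
(`admissibleSpeed_iff_exists_isProfile`).

The right side increases with `w`, so comparison works backwards from the right end
(`le_add_of_super_of_sub`). Since `q` is integrable, for every `c` there is a profile vanishing at
`1` (`exists_isProfile_tendsto_one`). It lies below every positive subsolution, whatever the latter
does at `1`. Hence `c` is admissible as soon as some positive subsolution tends to `0` at `0`.

The set of admissible speeds is an upper half-line: adding `(c' - c) ∫ g` to a profile for `c` gives
a subsolution for `c' ≥ c`. It is nonempty by an explicit subsolution for large `c`, where `ℓ₀ < ∞`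
enters. It is closed by comparison with slightly perturbed profiles. It is bounded below because `0
< w < H` with `H(x) = ∫₀ˣ h`; this inequality also gives (a).

For (b) and (c), try `v = t H`. It is a subsolution when `d ρ^(p-1) ≤ t (1-t)^(p-1) h^(p-1) H`, and
`t (1-t)^(p-1)` has maximum `(p-1)^(p-1)/p^p`, at `t = 1/p`. So `H/p` proves (b). For (c), a bound
`w ≤ t H` improves itself to `w ≤ (1 - (l t)^(-r)) H`, and at the best `t` this contradicts that
maximum. -/

/-! ### Backward comparison. -/

/-- A continuous function that is nondecreasing wherever it is positive and is at most `η ≥ 0` at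
the right end of an interval is at most `η` on the whole interval. -/
theorem le_of_deriv_nonneg_of_pos {a b η : ℝ} {D : ℝ → ℝ} (hη : 0 ≤ η)
    (hc : ContinuousOn D (Icc a b))
    (hd : ∀ x ∈ Ioo a b, 0 < D x → ∃ D', 0 ≤ D' ∧ HasDerivAt D D' x) (hb : D b ≤ η) :
    ∀ x ∈ Icc a b, D x ≤ η := by
  intro x hx
  by_contra! hxη
  -- The first point `c` right of `x` with `D c ≤ η`: before it `D > η ≥ 0`, so `D` is nondecreasing
  -- up to `c` and `D x ≤ D c`.
  set S := Icc x b ∩ D ⁻¹' Iic η with hS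
  have hcx : ContinuousOn D (Icc x b) := hc.mono (Icc_subset_Icc_left hx.1)
  have hSc : IsClosed S := hcx.preimage_isClosed_of_isClosed isClosed_Icc isClosed_Iic
  have hSb : b ∈ S := ⟨⟨hx.2, le_rfl⟩, hb⟩
  have hbd : BddBelow S := ⟨x, fun y hy => hy.1.1⟩
  have hmem := hSc.csInf_mem ⟨b, hSb⟩ hbd
  set c := sInf S
  have hlt : ∀ y ∈ Ioo x c, η < D y := by
    intro y hy
    by_contra! h
    exact (csInf_le hbd (show y ∈ S from ⟨⟨hy.1.le, hy.2.le.trans hmem.1.2⟩, h⟩)).not_gt hy.2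
  have hsub : Ioo x c ⊆ Ioo a b := Ioo_subset_Ioo hx.1 hmem.1.2
  have hmono : MonotoneOn D (Icc x c) := by
    refine monotoneOn_of_deriv_nonneg (convex_Icc _ _) (hcx.mono (Icc_subset_Icc_right hmem.1.2))
      ?_ ?_ <;> rw [interior_Icc] <;> intro y hy <;>
      obtain ⟨D', h0, h1⟩ := hd y (hsub hy) (hη.trans_lt (hlt y hy))
    · exact h1.differentiableAt.differentiableWithinAt
    · rwa [h1.deriv]
  have := hmono ⟨le_rfl, hmem.1.1⟩ ⟨hmem.1.1, le_rfl⟩ hmem.1.1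
  exact (hxη.trans_le this).not_ge hmem.2

/-- Backward comparison for `w' = h - q w⁻ʳ`. -/
theorem le_add_of_super_of_sub {a b η r : ℝ} {h q v w : ℝ → ℝ} (hr : 0 < r) (hη : 0 ≤ η)
    (hq : ∀ x ∈ Ioo a b, 0 ≤ q x)
    (hwc : ContinuousOn w (Icc a b)) (hvc : ContinuousOn v (Icc a b))
    (hv0 : ∀ x ∈ Ioo a b, 0 < v x)
    (hw : ∀ x ∈ Ioo a b, 0 < w x → ∃ D, HasDerivAt w D x ∧ h x - q x * w x ^ (-r) ≤ D)
    (hv : ∀ x ∈ Ioo a b, ∃ D, HasDerivAt v D x ∧ D ≤ h x - q x * v x ^ (-r))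
    (hb : w b ≤ v b + η) : ∀ x ∈ Icc a b, w x ≤ v x + η := by
  intro x hx
  have := le_of_deriv_nonneg_of_pos (D := fun x => w x - v x) hη (hwc.sub hvc) ?_
    (by linarith) x hx
  · linarith
  intro y hy hpos
  have hvw : v y < w y := by linarith
  obtain ⟨D1, h1, h1'⟩ := hw y hy ((hv0 y hy).trans hvw)
  obtain ⟨D2, h2, h2'⟩ := hv y hy
  refine ⟨D1 - D2, ?_, h1.sub h2⟩
  have := Real.rpow_le_rpow_of_nonpos (hv0 y hy) hvw.le (neg_nonpos.2 hr.le)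
  have := mul_le_mul_of_nonneg_left this (hq y hy)
  linarith

/-! ### Solutions on compact intervals. -/

/-- Lower bound making the singular term dominate. -/
theorem exists_pos_rpow_neg_ge {r q₀ : ℝ} (hr : 0 < r) (hq₀ : 0 < q₀) (K : ℝ) :
    ∀ᶠ ε in 𝓝[>] (0 : ℝ), K ≤ q₀ * ε ^ (-r) :=
  ((tendsto_rpow_neg_nhdsGT_zero (neg_neg_of_pos hr)).const_mul_atTop hq₀).eventually_ge_atTop K

/-- Positive backward solution of `w' = h - q w⁻ʳ` on a compact interval. -/
theorem exists_solution_Icc {a b r η : ℝ} {h q : ℝ → ℝ} (hab : a ≤ b) (hr : 0 < r) (hη : 0 < η)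
    (hh : ContinuousOn h (Icc a b)) (hqc : ContinuousOn q (Icc a b))
    (hq : ∀ x ∈ Icc a b, 0 < q x) :
    ∃ w : ℝ → ℝ, w b = η ∧ ContinuousOn w (Icc a b) ∧ (∀ x ∈ Icc a b, 0 < w x) ∧
      ∀ x ∈ Ioo a b, HasDerivAt w (h x - q x * w x ^ (-r)) x := by
  obtain ⟨x₀, hx₀, hmin⟩ := isCompact_Icc.exists_isMinOn (nonempty_Icc.2 hab) hqc
  obtain ⟨x₁, hx₁, hmax⟩ := isCompact_Icc.exists_isMaxOn (nonempty_Icc.2 hab) hqc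
  obtain ⟨M, hM⟩ := isCompact_Icc.exists_bound_of_continuousOn hh
  have hq₀ := hq x₀ hx₀
  have hq₁ := hq x₁ hx₁
  have hM0 : 0 ≤ M := (norm_nonneg _).trans (hM b ⟨hab, le_rfl⟩)
  -- At height `ε` the singular term outweighs `|h|`, so a backward solution starting at `η ≥ ε`
  -- never drops below `ε`. Replacing `w` by `max w ε` is then harmless, and makes the field
  -- globally Lipschitz in `w`.
  obtain ⟨ε, ⟨hε1, hε⟩, hε2 : 0 < ε⟩ := (((exists_pos_rpow_neg_ge hr hq₀ M).and
    (eventually_nhdsWithin_of_eventually_nhds (eventually_le_nhds hη))).and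
      self_mem_nhdsWithin).exists
  obtain ⟨K, hK⟩ : ∃ K : NNReal, LipschitzWith K (fun x : ℝ => (max x ε) ^ (-r)) := by
    have h1 : LipschitzOnWith (Real.toNNReal (r * ε ^ (-r - 1))) (fun x : ℝ => x ^ (-r))
        (Ici ε) := by
      refine (convex_Ici ε).lipschitzOnWith_of_nnnorm_hasDerivWithin_le
        (f' := fun x => -r * x ^ (-r - 1)) (fun x hx => ?_) (fun x hx => ?_)
      · exact (Real.hasDerivAt_rpow_const
          (Or.inl (hε2.trans_le hx).ne')).hasDerivWithinAt
      · have hx0 : 0 < x := hε2.trans_le hx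
        rw [← NNReal.coe_le_coe, coe_nnnorm, Real.coe_toNNReal _ (by positivity), norm_mul,
          norm_neg, Real.norm_of_nonneg hr.le, Real.norm_of_nonneg (by positivity)]
        exact mul_le_mul_of_nonneg_left
          (Real.rpow_le_rpow_of_nonpos hε2 hx (by linarith)) hr.le
    have h2 : LipschitzWith 1 (fun x : ℝ => max x ε) := LipschitzWith.id.max_const ε
    have h3 := h1.comp h2.lipschitzOnWith (s := univ) (fun x _ => le_max_right x ε)
    exact ⟨_, lipschitzOnWith_univ.1 h3⟩
  have hεr : ∀ x : ℝ, 0 < max x ε ^ (-r) ∧ max x ε ^ (-r) ≤ ε ^ (-r) := fun x =>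
    ⟨Real.rpow_pos_of_pos (hε2.trans_le (le_max_right _ _)) _,
      Real.rpow_le_rpow_of_nonpos hε2 (le_max_right _ _) (by linarith)⟩
  set L : ℝ := M + q x₁ * ε ^ (-r) with hL
  have hεp : 0 < ε ^ (-r) := Real.rpow_pos_of_pos hε2 _
  have hL0 : 0 ≤ L := by positivity
  -- The truncated field is bounded by `L` at every height, so radius `L (b - a)` yields a solution
  -- on all of `[a, b]`.
  have hPL : IsPicardLindelof (fun t x => h t - q t * max x ε ^ (-r))
      (⟨b, hab, le_rfl⟩ : Icc a b) η (Real.toNNReal (L * (b - a))) 0 (Real.toNNReal L)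
      (Real.toNNReal (q x₁) * K) := by
    constructor
    · intro t ht
      refine LipschitzWith.lipschitzOnWith ?_
      refine LipschitzWith.of_dist_le_mul fun x y => ?_
      have := hK.dist_le_mul x y
      rw [Real.dist_eq] at this ⊢
      have e : h t - q t * max x ε ^ (-r) - (h t - q t * max y ε ^ (-r))
        = - (q t * (max x ε ^ (-r) - max y ε ^ (-r))) := by ring
      rw [e, abs_neg, abs_mul, abs_of_pos (hq t ht), NNReal.coe_mul,
        Real.coe_toNNReal _ hq₁.le, mul_assoc]
      exact mul_le_mul (hmax ht) this (abs_nonneg _) hq₁.le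
    · intro x _
      exact hh.sub (hqc.mul continuousOn_const)
    · intro t ht x _
      rw [Real.coe_toNNReal _ hL0]
      refine (norm_sub_le _ _).trans (add_le_add (hM t ht) ?_)
      rw [Real.norm_of_nonneg (mul_pos (hq t ht) (hεr x).1).le]
      exact mul_le_mul (hmax ht) (hεr x).2 (hεr x).1.le hq₁.le
    · simp only [sub_self, NNReal.coe_zero, sub_zero]
      rw [Real.coe_toNNReal _ hL0, Real.coe_toNNReal _ (mul_nonneg hL0 (by linarith)),
        max_eq_right (by linarith)]
  obtain ⟨w, hwb, hw⟩ := hPL.exists_eq_forall_mem_Icc_hasDerivWithinAt₀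
  have hwc : ContinuousOn w (Icc a b) := fun x hx => (hw x hx).continuousWithinAt
  have hwd : ∀ x ∈ Ioo a b, HasDerivAt w (h x - q x * max (w x) ε ^ (-r)) x := fun x hx =>
    (hw x (Ioo_subset_Icc_self hx)).hasDerivAt (Icc_mem_nhds hx.1 hx.2)
  have hwε : ∀ x ∈ Icc a b, ε ≤ w x := by
    intro x hx
    have := le_of_deriv_nonneg_of_pos (D := fun x => ε - w x) le_rfl
      (continuousOn_const.sub hwc) ?_ (by rw [hwb]; linarith) x hx
    · linarith
    intro y hy hpos
    refine ⟨_, ?_, (hwd y hy).const_sub ε⟩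
    rw [max_eq_right (by linarith)]
    have hy' := Ioo_subset_Icc_self hy
    have h1 := mul_le_mul_of_nonneg_right (isMinOn_iff.1 hmin y hy') hεp.le
    have h2 := (le_abs_self _).trans (hM y hy')
    linarith
  refine ⟨w, hwb, hwc, fun x hx => hε2.trans_le (hwε x hx), fun x hx => ?_⟩
  have := hwd x hx
  rwa [max_eq_left (hwε x (Ioo_subset_Icc_self hx))] at this

/-! ### Profiles, subsolutions and the profile vanishing at `1`. -/

/-- Positive solution on `(0, 1)` of `w' = h - q w⁻ʳ`. -/
def IsProfile (r : ℝ) (h q w : ℝ → ℝ) : Prop :=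
  ∀ x ∈ Ioo (0 : ℝ) 1, 0 < w x ∧ HasDerivAt w (h x - q x * w x ^ (-r)) x

/-- Positive subsolution on `(0, 1)` of `w' = h - q w⁻ʳ`. -/
def IsSubprofile (r : ℝ) (h q v : ℝ → ℝ) : Prop :=
  ∀ x ∈ Ioo (0 : ℝ) 1, 0 < v x ∧ ∃ D, HasDerivAt v D x ∧ D ≤ h x - q x * v x ^ (-r)

theorem IsProfile.isSubprofile {r : ℝ} {h q w : ℝ → ℝ} (hw : IsProfile r h q w) :
    IsSubprofile r h q w := fun x hx => ⟨(hw x hx).1, _, (hw x hx).2, le_rfl⟩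

theorem IsSubprofile.continuousOn {r : ℝ} {h q v : ℝ → ℝ} (hv : IsSubprofile r h q v) :
    ContinuousOn v (Ioo 0 1) := fun x hx => by
  obtain ⟨-, D, hD, -⟩ := hv x hx
  exact hD.continuousAt.continuousWithinAt

/-- Only `w` has to vanish at `1`: near `1` one has `w < η < v + η`, backward comparison carries
this to the left, and `η → 0`. -/
theorem IsProfile.le_of_isSubprofile {r : ℝ} {h q v w : ℝ → ℝ} (hr : 0 < r)
    (hq : ∀ x ∈ Ioo (0 : ℝ) 1, 0 < q x) (hw : IsProfile r h q w)
    (hw1 : Tendsto w (𝓝[<] 1) (𝓝 0)) (hv : IsSubprofile r h q v) :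
    ∀ x ∈ Ioo (0 : ℝ) 1, w x ≤ v x := by
  intro x hx
  refine le_of_forall_pos_le_add fun η hη => ?_
  obtain ⟨b, hb, hb'⟩ := ((hw1.eventually (eventually_lt_nhds hη)).and
    (Ioo_mem_nhdsLT hx.2)).exists
  have hsub : Icc x b ⊆ Ioo 0 1 := fun y hy => ⟨hx.1.trans_le hy.1, hy.2.trans_lt hb'.2⟩
  have hsub' : Ioo x b ⊆ Ioo 0 1 := Ioo_subset_Icc_self.trans hsub
  have hvb := (hv b (hsub ⟨hb'.1.le, le_rfl⟩)).1
  exact le_add_of_super_of_sub (h := h) (q := q) hr hη.le (fun y hy => (hq y (hsub' hy)).le)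
    (hw.isSubprofile.continuousOn.mono hsub) (hv.continuousOn.mono hsub)
    (fun y hy => (hv y (hsub' hy)).1) (fun y hy _ => ⟨_, (hw y (hsub' hy)).2, le_rfl⟩)
    (fun y hy => (hv y (hsub' hy)).2) (by linarith) x ⟨le_rfl, hb'.1.le⟩

/-- A subsolution vanishing at `1`. -/
theorem exists_isSubprofile_tendsto_one {r M : ℝ} {h q : ℝ → ℝ} (hr : 0 < r)
    (hM : ∀ x ∈ Ioo (0 : ℝ) 1, |h x| ≤ M)
    (hqc : ContinuousOn q (Ioo 0 1)) (hq : ∀ x ∈ Ioo (0 : ℝ) 1, 0 < q x)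
    (hqi : IntegrableOn q (Ioo 0 1)) :
    ∃ B : ℝ → ℝ, IsSubprofile r h q B ∧ Tendsto B (𝓝[<] 1) (𝓝 0) := by
  have hM0 : 0 ≤ M := (abs_nonneg _).trans (hM (1 / 2) (by norm_num))
  have hi : IntervalIntegrable (fun x => q x + 1) volume 0 1 := by
    rw [intervalIntegrable_iff_integrableOn_Ioo_of_le zero_le_one]
    exact hqi.add (by simp)
  -- In the slope of `(C Y)^s` the summand `q` will absorb the singular term, and the summand `1`
  -- will absorb `h`.
  set Y : ℝ → ℝ := fun x => ∫ t in x..1, (q t + 1) with hY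
  have hYc : ContinuousOn Y (Icc 0 1) := by
    have := intervalIntegral.continuousOn_primitive_interval' hi (a := 1) (by simp)
    rw [uIcc_of_le zero_le_one] at this
    refine this.neg.congr fun x _ => ?_
    simp only [hY]; rw [intervalIntegral.integral_symm]
    rfl
  have hcont : ∀ x ∈ Ioo (0 : ℝ) 1, ContinuousAt (fun x => q x + 1) x := fun x hx =>
    (hqc.continuousAt (Ioo_mem_nhds hx.1 hx.2)).add continuousAt_const
  have hYd : ∀ x ∈ Ioo (0 : ℝ) 1, HasDerivAt Y (-(q x + 1)) x := by
    intro x hx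
    refine intervalIntegral.integral_hasDerivAt_left (hi.mono_set ?_) ?_ (hcont x hx)
    · rw [uIcc_of_le zero_le_one, uIcc_of_le hx.2.le]
      exact Icc_subset_Icc_left hx.1.le
    · exact ContinuousAt.stronglyMeasurableAtFilter isOpen_Ioo hcont x hx
  have hYpos : ∀ x ∈ Ioo (0 : ℝ) 1, 0 < Y x := by
    intro x hx
    refine intervalIntegral.intervalIntegral_pos_of_pos_on (hi.mono_set ?_) ?_ hx.2
    · rw [uIcc_of_le zero_le_one, uIcc_of_le hx.2.le]
      exact Icc_subset_Icc_left hx.1.le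
    · intro y hy
      have := hq y ⟨hx.1.trans hy.1, hy.2⟩
      linarith
  obtain ⟨m, hm⟩ := isCompact_Icc.exists_bound_of_continuousOn hYc
  have hm0 : 0 ≤ m := (norm_nonneg _).trans (hm 1 (by simp))
  -- This exponent makes `B^(-r)` and `B'` carry the same power `(C Y)^(s-1)` for `B = (C Y)^s`.
  set s := 1 / (r + 1) with hs
  have hs0 : 0 < s := by positivity
  have hrs : 1 - s = r * s := by rw [hs]; field_simp; ring
  obtain ⟨C, hC1, hC2, hC0⟩ : ∃ C : ℝ, 1 ≤ s * C ∧ M * m ^ (r * s) ≤ s * C ^ s ∧ 0 < C := by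
    have h1 := (tendsto_id (α := ℝ) (x := atTop)).const_mul_atTop hs0
    have h2 := (tendsto_rpow_atTop hs0).const_mul_atTop hs0
    obtain ⟨C, ⟨h3, h4⟩, h5⟩ := (((h1.eventually_ge_atTop 1).and
      (h2.eventually_ge_atTop (M * m ^ (r * s)))).and (eventually_gt_atTop 0)).exists
    exact ⟨C, h3, h4, h5⟩
  refine ⟨fun x => (C * Y x) ^ s, fun x hx => ?_, ?_⟩
  · have hy := mul_pos hC0 (hYpos x hx)
    refine ⟨Real.rpow_pos_of_pos hy _, _,
      ((hYd x hx).const_mul C).rpow_const (Or.inl hy.ne'), ?_⟩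
    rw [← Real.rpow_mul hy.le, show s * -r = s - 1 by linarith [hrs]]
    set z := (C * Y x) ^ (s - 1) with hz
    have hz0 : 0 < z := Real.rpow_pos_of_pos hy _
    have hYm : Y x ≤ m := (le_abs_self _).trans (hm x (Ioo_subset_Icc_self hx))
    have key : M ≤ s * C * z := by
      have e : z * (C * Y x) ^ (r * s) = 1 := by
        rw [hz, ← Real.rpow_add hy, ← hrs]; simp
      have e2 : (C * Y x) ^ (r * s) ≤ C ^ (r * s) * m ^ (r * s) := by
        rw [← Real.mul_rpow hC0.le hm0]
        exact Real.rpow_le_rpow hy.le (mul_le_mul_of_nonneg_left hYm hC0.le) (by positivity)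
      have e3 : C ^ (r * s) * C ^ s = C := by
        rw [← Real.rpow_add hC0, ← hrs]; simp
      have e4 : M * (C * Y x) ^ (r * s) ≤ s * C := by
        calc M * (C * Y x) ^ (r * s) ≤ M * (C ^ (r * s) * m ^ (r * s)) :=
              mul_le_mul_of_nonneg_left e2 hM0
          _ = C ^ (r * s) * (M * m ^ (r * s)) := by ring
          _ ≤ C ^ (r * s) * (s * C ^ s) :=
              mul_le_mul_of_nonneg_left hC2 (by positivity)
          _ = s * (C ^ (r * s) * C ^ s) := by ring
          _ = s * C := by rw [e3]
      calc M = M * (C * Y x) ^ (r * s) * z := by rw [mul_assoc, mul_comm _ z, e, mul_one]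
        _ ≤ s * C * z := mul_le_mul_of_nonneg_right e4 hz0.le
    have h1 := (abs_le.1 (hM x hx)).1
    have h2 : q x * z ≤ (s * C) * (q x * z) :=
      le_mul_of_one_le_left (mul_pos (hq x hx) hz0).le hC1
    nlinarith
  · have h1 : Tendsto Y (𝓝[<] 1) (𝓝 (Y 1)) :=
      (hYc 1 (by simp)).mono_left (by
        rw [← nhdsWithin_Ioo_eq_nhdsLT (zero_lt_one' ℝ)]
        exact nhdsWithin_mono _ Ioo_subset_Icc_self)
    have h2 : Y 1 = 0 := by simp [hY]
    have h3 := (h1.const_mul C).rpow_const (p := s) (Or.inr hs0.le)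
    rwa [h2, mul_zero, Real.zero_rpow hs0.ne'] at h3

/-- Interior lower bound for positive solutions. -/
theorem exists_lower_bound {a b c r : ℝ} {h q : ℝ → ℝ} (hr : 0 < r) (hab : a ≤ b) (hbc : b < c)
    (hh : ContinuousOn h (Icc a c)) (hqc : ContinuousOn q (Icc a c))
    (hq : ∀ x ∈ Icc a c, 0 < q x) :
    ∃ m > 0, ∀ w : ℝ → ℝ, ContinuousOn w (Icc a c) → (∀ x ∈ Icc a c, 0 < w x) →
      (∀ x ∈ Ioo a c, HasDerivAt w (h x - q x * w x ^ (-r)) x) → ∀ x ∈ Icc a b, m ≤ w x := by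
  have hac : a ≤ c := hab.trans hbc.le
  obtain ⟨x₀, hx₀, hmin⟩ := isCompact_Icc.exists_isMinOn (nonempty_Icc.2 hac) hqc
  obtain ⟨M, hM⟩ := isCompact_Icc.exists_bound_of_continuousOn hh
  have hq₀ := hq x₀ hx₀
  obtain ⟨ε, ⟨hε1, hε⟩, hε2 : 0 < ε⟩ := (((exists_pos_rpow_neg_ge hr hq₀ (M + 1)).and
    (eventually_nhdsWithin_of_eventually_nhds (eventually_le_nhds zero_lt_one))).and
      self_mem_nhdsWithin).exists
  set L := c - a with hL
  have hL0 : 0 < L := by linarith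
  -- The barrier is linear and vanishes at `c`, so it starts below any positive `w`. Its height is
  -- at most `ε`, hence `h - q (·)^(-r) ≤ -1`, while its slope is at least `-1` because `ε ≤ 1`.
  refine ⟨ε / (L + 1) * (c - b), by have : 0 < c - b := by linarith
                                    positivity, fun w hwc hw0 hw x hx => ?_⟩
  have hk0 : 0 < ε / (L + 1) := by positivity
  have hk : ε / (L + 1) ≤ ε := div_le_self hε2.le (by linarith)
  have := le_add_of_super_of_sub (a := a) (b := c) (η := 0) (r := r) (h := h) (q := q) (v := w)
    (w := fun x => ε / (L + 1) * (c - x)) hr le_rfl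
    (fun y hy => (hq y (Ioo_subset_Icc_self hy)).le) (by fun_prop) hwc
    (fun y hy => hw0 y (Ioo_subset_Icc_self hy)) ?_ (fun y hy => ⟨_, hw y hy, le_rfl⟩)
    (by simpa using (hw0 c ⟨hac, le_rfl⟩).le) x ⟨hx.1, hx.2.trans hbc.le⟩
  · refine le_trans (mul_le_mul_of_nonneg_left (by linarith [hx.2]) hk0.le) (this.trans ?_)
    simp
  intro y hy hpos
  refine ⟨_, ((hasDerivAt_id y).const_sub c).const_mul _, ?_⟩
  have hle : ε / (L + 1) * (c - y) ≤ ε := by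
    rw [div_mul_eq_mul_div, div_le_iff₀ (by positivity)]
    exact mul_le_mul_of_nonneg_left (by linarith [hy.1]) hε2.le
  have hy' := Ioo_subset_Icc_self hy
  have h1 := Real.rpow_le_rpow_of_nonpos hpos hle (neg_nonpos.2 hr.le)
  have h2 := mul_le_mul (isMinOn_iff.1 hmin y hy') h1 (Real.rpow_nonneg hε2.le _) (hq y hy').le
  have h3 := (le_abs_self _).trans (hM y hy')
  linarith

/-- An integral equation passes to pointwise limits of solutions that are bounded below. -/
theorem hasDerivAt_of_tendsto_solutions {a b r m : ℝ} {h q W : ℝ → ℝ} {w : ℕ → ℝ → ℝ}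
    (hr : 0 < r) (hm : 0 < m) (hh : ContinuousOn h (Icc a b)) (hqc : ContinuousOn q (Icc a b))
    (hw : ∀ᶠ n in atTop, ∀ x ∈ Icc a b,
      m ≤ w n x ∧ HasDerivAt (w n) (h x - q x * w n x ^ (-r)) x)
    (hW : ∀ x ∈ Icc a b, Tendsto (fun n => w n x) atTop (𝓝 (W x))) :
    ∀ x ∈ Ioo a b, HasDerivAt W (h x - q x * W x ^ (-r)) x := by
  intro x hx
  have hab : a ≤ b := (hx.1.trans hx.2).le
  have hWm : ∀ y ∈ Icc a b, m ≤ W y := fun y hy =>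
    ge_of_tendsto (hW y hy) (hw.mono fun n hn => (hn y hy).1)
  obtain ⟨M, hM⟩ := isCompact_Icc.exists_bound_of_continuousOn hh
  obtain ⟨Q, hQ⟩ := isCompact_Icc.exists_bound_of_continuousOn hqc
  set F : ℝ → ℝ → ℝ := fun y z => h y - q y * z ^ (-r) with hF
  -- The common lower bound `m` tames the singularity and supplies the constant for dominated
  -- convergence.
  have hbound : ∀ y ∈ Icc a b, ∀ z, m ≤ z → ‖F y z‖ ≤ M + Q * m ^ (-r) := by
    intro y hy z hz
    refine (norm_sub_le _ _).trans (add_le_add (hM y hy) ?_)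
    rw [norm_mul, Real.norm_of_nonneg (Real.rpow_nonneg (hm.le.trans hz) _)]
    exact mul_le_mul (hQ y hy) (Real.rpow_le_rpow_of_nonpos hm hz (by linarith))
      (Real.rpow_nonneg (hm.le.trans hz) _) ((norm_nonneg _).trans (hQ y hy))
  have hlim : ∀ y ∈ Icc a b, Tendsto (fun n => F y (w n y)) atTop (𝓝 (F y (W y))) :=
    fun y hy => (((hW y hy).rpow_const
      (Or.inl (hm.trans_le (hWm y hy)).ne')).const_mul _).const_sub _
  have hcont : ∀ᶠ n in atTop, ContinuousOn (fun y => F y (w n y)) (Icc a b) := by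
    filter_upwards [hw] with n hn
    refine hh.sub (hqc.mul (ContinuousOn.rpow_const (fun y hy =>
      (hn y hy).2.continuousAt.continuousWithinAt) fun y hy =>
      Or.inl (hm.trans_le (hn y hy).1).ne'))
  have hmeas : ∀ᶠ n in atTop,
      AEStronglyMeasurable (fun y => F y (w n y)) (volume.restrict (Icc a b)) :=
    hcont.mono fun n hn => hn.aestronglyMeasurable measurableSet_Icc
  have hlimae : ∀ᵐ y ∂(volume.restrict (Icc a b)),
      Tendsto (fun n => F y (w n y)) atTop (𝓝 (F y (W y))) :=
    (ae_restrict_iff' measurableSet_Icc).2 (ae_of_all _ hlim)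
  have hmeasW : AEStronglyMeasurable (fun y => F y (W y)) (volume.restrict (Icc a b)) := by
    obtain ⟨N, hN⟩ := eventually_atTop.1 hmeas
    exact aestronglyMeasurable_of_tendsto_ae atTop (f := fun n y => F y (w (n + N) y))
      (fun n => hN _ (Nat.le_add_left _ _))
      (hlimae.mono fun y hy => (tendsto_add_atTop_iff_nat N).2 hy)
  have hint : IntegrableOn (fun y => F y (W y)) (Icc a b) :=
    Integrable.of_bound hmeasW _
      ((ae_restrict_iff' measurableSet_Icc).2 (ae_of_all _ fun y hy => hbound y hy _ (hWm y hy)))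
  have hint' : IntervalIntegrable (fun y => F y (W y)) volume a b := by
    rw [intervalIntegrable_iff_integrableOn_Icc_of_le hab]; exact hint
  have heq : ∀ y ∈ Icc a b, W y = W a + ∫ t in a..y, F t (W t) := by
    intro y hy
    have hsub : Icc a y ⊆ Icc a b := Icc_subset_Icc_right hy.2
    have hsub' : Ioc a y ⊆ Icc a b := Ioc_subset_Icc_self.trans hsub
    have h1 : Tendsto (fun n => ∫ t in a..y, F t (w n t)) atTop
        (𝓝 (∫ t in a..y, F t (W t))) := by
      refine intervalIntegral.tendsto_integral_filter_of_dominated_convergence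
        (fun _ => M + Q * m ^ (-r)) ?_ ?_ (by simp) ?_
      · rw [uIoc_of_le hy.1]
        exact hmeas.mono fun n hn => hn.mono_measure (Measure.restrict_mono hsub' le_rfl)
      · rw [uIoc_of_le hy.1]
        exact hw.mono fun n hn => ae_of_all _ fun t ht =>
          hbound t (hsub' ht) _ (hn t (hsub' ht)).1
      · rw [uIoc_of_le hy.1]
        exact ae_of_all _ fun t ht => hlim t (hsub' ht)
    have h2 : Tendsto (fun n => w n y - w n a) atTop (𝓝 (W y - W a)) :=
      (hW y hy).sub (hW a ⟨le_rfl, hab⟩)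
    have h3 : (fun n => ∫ t in a..y, F t (w n t)) =ᶠ[atTop] fun n => w n y - w n a := by
      filter_upwards [hw, hcont] with n hn hn'
      refine intervalIntegral.integral_eq_sub_of_hasDerivAt ?_ ?_
      · rw [uIcc_of_le hy.1]; exact fun t ht => (hn t (hsub ht)).2
      · refine ContinuousOn.intervalIntegrable ?_
        rw [uIcc_of_le hy.1]; exact hn'.mono hsub
    have := tendsto_nhds_unique (h1.congr' h3) h2
    linarith
  have hWc : ContinuousOn W (Icc a b) := by
    have := intervalIntegral.continuousOn_primitive_interval' hint' (a := a) (by simp)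
    rw [uIcc_of_le hab] at this
    exact (continuousOn_const.add this).congr heq
  have hFc : ContinuousOn (fun y => F y (W y)) (Icc a b) :=
    hh.sub (hqc.mul (hWc.rpow_const fun y hy => Or.inl (hm.trans_le (hWm y hy)).ne'))
  have hFca : ∀ y ∈ Ioo a b, ContinuousAt (fun y => F y (W y)) y := fun y hy =>
    hFc.continuousAt (Icc_mem_nhds hy.1 hy.2)
  have hd : HasDerivAt (fun y => ∫ t in a..y, F t (W t)) (F x (W x)) x := by
    refine intervalIntegral.integral_hasDerivAt_right (hint'.mono_set ?_)
      (ContinuousAt.stronglyMeasurableAtFilter isOpen_Ioo hFca x hx) (hFca x hx)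
    rw [uIcc_of_le hx.1.le, uIcc_of_le hab]
    exact Icc_subset_Icc_right hx.2.le
  refine (hd.const_add (W a)).congr_of_eventuallyEq ?_
  filter_upwards [Icc_mem_nhds hx.1 hx.2] with y hy using heq y hy

/-- The profile vanishing at `1`; it lies below every subsolution by
`IsProfile.le_of_isSubprofile`. -/
theorem exists_isProfile_tendsto_one {r : ℝ} {h q : ℝ → ℝ} (hr : 0 < r)
    (hh : ContinuousOn h (Icc 0 1)) (hqc : ContinuousOn q (Ioo 0 1))
    (hq : ∀ x ∈ Ioo (0 : ℝ) 1, 0 < q x) (hqi : IntegrableOn q (Ioo 0 1)) :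
    ∃ W : ℝ → ℝ, IsProfile r h q W ∧ Tendsto W (𝓝[<] 1) (𝓝 0) := by
  obtain ⟨M, hM⟩ := isCompact_Icc.exists_bound_of_continuousOn hh
  obtain ⟨B, hB, hB1⟩ := exists_isSubprofile_tendsto_one hr
    (fun x hx => hM x (Ioo_subset_Icc_self hx)) hqc hq hqi
  set a : ℕ → ℝ := fun n => 1 / ((n : ℝ) + 3) with ha
  have ha0 : ∀ n, 0 < a n := fun n => by positivity
  have ha1 : ∀ n, a n ≤ 1 / 3 := fun n =>
    one_div_le_one_div_of_le (by norm_num) (by linarith [n.cast_nonneg (α := ℝ)])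
  have hanti : Antitone a := fun n k hnk =>
    one_div_le_one_div_of_le (by positivity) (by
      have : (n : ℝ) ≤ k := by exact_mod_cast hnk
      linarith)
  have halim : Tendsto a atTop (𝓝 0) := by
    have : Tendsto (fun n : ℕ => (n : ℝ) + 3) atTop atTop :=
      tendsto_atTop_add_const_right _ _ tendsto_natCast_atTop_atTop
    exact this.inv_tendsto_atTop.congr fun n => by simp [ha]
  have hJ : ∀ n, Icc (a n) (1 - a n) ⊆ Ioo 0 1 := fun n x hx =>
    ⟨(ha0 n).trans_le hx.1, by linarith [hx.2, ha0 n]⟩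
  have hJ' : ∀ n, Ioo (a n) (1 - a n) ⊆ Ioo 0 1 := fun n => Ioo_subset_Icc_self.trans (hJ n)
  have hb : ∀ n, 1 - a n ∈ Ioo (0 : ℝ) 1 := fun n => ⟨by linarith [ha1 n], by linarith [ha0 n]⟩
  have hle : ∀ n, a n ≤ 1 - a n := fun n => by linarith [ha1 n]
  -- Each approximation starts on the graph of the subsolution `B` at its right endpoint. It
  -- therefore stays below `B`, and enlarging the interval can only lower it: the sequence decreases
  -- in `n`.
  choose w hwb hwc hw0 hw using fun n => exists_solution_Icc (r := r) (h := h) (q := q)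
    (η := B (1 - a n)) (hle n) hr (hB _ (hb n)).1
    (hh.mono ((hJ n).trans Ioo_subset_Icc_self)) (hqc.mono (hJ n))
    (fun x hx => hq x (hJ n hx))
  have hwB : ∀ n, ∀ x ∈ Icc (a n) (1 - a n), w n x ≤ B x := by
    intro n x hx
    simpa using le_add_of_super_of_sub (η := 0) (h := h) (q := q) hr le_rfl
      (fun y hy => (hq y (hJ' n hy)).le) (hwc n) (hB.continuousOn.mono (hJ n))
      (fun y hy => (hB y (hJ' n hy)).1) (fun y hy _ => ⟨_, hw n y hy, le_rfl⟩)
      (fun y hy => (hB y (hJ' n hy)).2) (by rw [hwb]; simp) x hx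
  have hww : ∀ n k, n ≤ k → ∀ x ∈ Icc (a n) (1 - a n), w k x ≤ w n x := by
    intro n k hnk x hx
    have hk := hanti hnk
    have hsub : Icc (a n) (1 - a n) ⊆ Icc (a k) (1 - a k) := Icc_subset_Icc hk (by linarith)
    have hsub' : Ioo (a n) (1 - a n) ⊆ Ioo (a k) (1 - a k) := Ioo_subset_Ioo hk (by linarith)
    simpa using le_add_of_super_of_sub (η := 0) (h := h) (q := q) hr le_rfl
      (fun y hy => (hq y (hJ' n hy)).le) ((hwc k).mono hsub) (hwc n)
      (fun y hy => hw0 n y (Ioo_subset_Icc_self hy))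
      (fun y hy _ => ⟨_, hw k y (hsub' hy), le_rfl⟩)
      (fun y hy => ⟨_, hw n y hy, le_rfl⟩)
      (by rw [hwb, add_zero]; exact hwB k _ (hsub ⟨hle n, le_rfl⟩)) x hx
  have hex : ∀ c d : ℝ, 0 < c → d < 1 → ∀ᶠ n in atTop, a n < c ∧ d < 1 - a n := by
    intro c d hc hd
    filter_upwards [halim.eventually (eventually_lt_nhds hc),
      halim.eventually (eventually_lt_nhds (sub_pos.2 hd))] with n h1 h2
    exact ⟨h1, by linarith⟩
  have hlim : ∀ x, ∃ L, x ∈ Ioo (0 : ℝ) 1 → Tendsto (fun n => w n x) atTop (𝓝 L) := by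
    intro x
    by_cases hx : x ∈ Ioo (0 : ℝ) 1
    · obtain ⟨N, hN⟩ := eventually_atTop.1 (hex x x hx.1 hx.2)
      have hN' : ∀ n, N ≤ n → x ∈ Icc (a n) (1 - a n) := fun n hn =>
        ⟨(hN n hn).1.le, (hN n hn).2.le⟩
      have h1 : Antitone fun n => w (n + N) x := fun n k hnk =>
        hww _ _ (by omega) x (hN' _ (by omega))
      have h2 : BddBelow (range fun n => w (n + N) x) := by
        refine ⟨0, ?_⟩
        rintro _ ⟨n, rfl⟩
        exact (hw0 _ x (hN' _ (by omega))).le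
      exact ⟨_, fun _ => (tendsto_add_atTop_iff_nat N).1 (tendsto_atTop_ciInf h1 h2)⟩
    · exact ⟨0, fun h => absurd h hx⟩
  choose W hW using hlim
  have hprof : IsProfile r h q W := by
    intro x hx
    have h1 := hx.1
    have h2 := hx.2
    -- `exists_lower_bound` needs room on the right, hence two right endpoints `(x + 1) / 2 < (x +
    -- 2) / 3`.
    have hsub : Icc (x / 2) ((x + 2) / 3) ⊆ Ioo (0 : ℝ) 1 := fun y hy =>
      ⟨by linarith [hy.1], by linarith [hy.2]⟩
    have hsub1 : Icc (x / 2) ((x + 1) / 2) ⊆ Icc (x / 2) ((x + 2) / 3) :=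
      Icc_subset_Icc_right (by linarith)
    have hhc := hh.mono (hsub.trans Ioo_subset_Icc_self)
    obtain ⟨m, hm, hlow⟩ := exists_lower_bound (a := x / 2) (b := (x + 1) / 2)
      (c := (x + 2) / 3) hr (by linarith) (by linarith) hhc (hqc.mono hsub)
      (fun y hy => hq y (hsub hy))
    have hev := hex (x / 2) ((x + 2) / 3) (by linarith) (by linarith)
    have hmW : ∀ᶠ n in atTop, ∀ y ∈ Icc (x / 2) ((x + 1) / 2),
        m ≤ w n y ∧ HasDerivAt (w n) (h y - q y * w n y ^ (-r)) y := by
      filter_upwards [hev] with n hn y hy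
      have hs : Icc (x / 2) ((x + 2) / 3) ⊆ Ioo (a n) (1 - a n) := fun z hz =>
        ⟨hn.1.trans_le hz.1, hz.2.trans_lt hn.2⟩
      exact ⟨hlow (w n) ((hwc n).mono (hs.trans Ioo_subset_Icc_self))
        (fun z hz => hw0 n z (Ioo_subset_Icc_self (hs hz)))
        (fun z hz => hw n z (hs (Ioo_subset_Icc_self hz))) y hy, hw n y (hs (hsub1 hy))⟩
    have hxI : x ∈ Ioo (x / 2) ((x + 1) / 2) := ⟨by linarith, by linarith⟩
    exact ⟨hm.trans_le (ge_of_tendsto (hW x hx)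
        (hmW.mono fun n hn => (hn x (Ioo_subset_Icc_self hxI)).1)),
      hasDerivAt_of_tendsto_solutions hr hm (hhc.mono hsub1) (hqc.mono (hsub1.trans hsub)) hmW
        (fun y hy => hW y (hsub (hsub1 hy))) x hxI⟩
  refine ⟨W, hprof, ?_⟩
  refine tendsto_of_tendsto_of_tendsto_of_le_of_le' tendsto_const_nhds hB1 ?_ ?_
  · filter_upwards [Ioo_mem_nhdsLT zero_lt_one] with x hx using (hprof x hx).1.le
  · filter_upwards [Ioo_mem_nhdsLT zero_lt_one] with x hx
    refine le_of_tendsto (hW x hx) ((hex x x hx.1 hx.2).mono fun n hn => ?_)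
    exact hwB n x ⟨hn.1.le, hn.2.le⟩

/-! ### Intervals with extended real endpoints, their end filters, and inverse functions. -/

theorem isOpen_openInterval (α β : EReal) : IsOpen (openInterval α β) :=
  isOpen_Ioo.preimage continuous_coe_real_ereal

theorem ordConnected_openInterval (α β : EReal) : (openInterval α β).OrdConnected :=
  (ordConnected_Ioo (a := α) (b := β)).preimage_mono EReal.coe_strictMono.monotone

theorem eventually_rightOf_mem {α β : EReal} (h : α < β) :
    ∀ᶠ t in rightOf α, t ∈ openInterval α β :=
  preimage_mem_comap (Ioo_mem_nhdsGT h)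

theorem eventually_leftOf_mem {α β : EReal} (h : α < β) :
    ∀ᶠ t in leftOf β, t ∈ openInterval α β :=
  preimage_mem_comap (Ioo_mem_nhdsLT h)

theorem eventually_rightOf_lt {α : EReal} {t₀ : ℝ} (h : α < t₀) : ∀ᶠ t in rightOf α, t < t₀ :=
  (eventually_rightOf_mem h).mono fun _ ht => EReal.coe_lt_coe_iff.1 ht.2

theorem eventually_leftOf_gt {β : EReal} {t₀ : ℝ} (h : (t₀ : EReal) < β) :
    ∀ᶠ t in leftOf β, t₀ < t :=
  (eventually_leftOf_mem h).mono fun _ ht => EReal.coe_lt_coe_iff.1 ht.1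

theorem rightOf_neBot {α β : EReal} (h : α < β) : (rightOf α).NeBot := by
  refine comap_neBot_iff.2 fun s hs => ?_
  obtain ⟨γ, hγ, hs⟩ := (mem_nhdsGT_iff_exists_Ioo_subset' h).1 hs
  obtain ⟨t, h1, h2⟩ := EReal.lt_iff_exists_real_btwn.1 (show α < γ from hγ)
  exact ⟨t, hs ⟨h1, h2⟩⟩

theorem leftOf_neBot {α β : EReal} (h : α < β) : (leftOf β).NeBot := by
  refine comap_neBot_iff.2 fun s hs => ?_
  obtain ⟨γ, hγ, hs⟩ := (mem_nhdsLT_iff_exists_Ioo_subset' h).1 hs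
  obtain ⟨t, h1, h2⟩ := EReal.lt_iff_exists_real_btwn.1 (show γ < β from hγ)
  exact ⟨t, hs ⟨h1, h2⟩⟩

/-- Reals are dense in `EReal`, so convergence to a possibly infinite endpoint can be tested on real
points of the interval. -/
theorem tendsto_rightOf {ι : Type*} {l : Filter ι} {T : ι → ℝ} {α β : EReal} (h : α < β)
    (h1 : ∀ᶠ x in l, T x ∈ openInterval α β)
    (h2 : ∀ t₀ ∈ openInterval α β, ∀ᶠ x in l, T x < t₀) : Tendsto T l (rightOf α) := by
  refine tendsto_comap_iff.2 (tendsto_nhdsWithin_iff.2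
    ⟨tendsto_order.2 ⟨fun γ hγ => h1.mono fun x hx => hγ.trans hx.1, fun γ hγ => ?_⟩,
      h1.mono fun x hx => hx.1⟩)
  obtain ⟨t, h3, h4⟩ := EReal.lt_iff_exists_real_btwn.1 (lt_min hγ h)
  exact (h2 t ⟨h3, h4.trans_le (min_le_right _ _)⟩).mono fun x hx =>
    (EReal.coe_lt_coe_iff.2 hx).trans (h4.trans_le (min_le_left _ _))

theorem tendsto_leftOf {ι : Type*} {l : Filter ι} {T : ι → ℝ} {α β : EReal} (h : α < β)
    (h1 : ∀ᶠ x in l, T x ∈ openInterval α β)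
    (h2 : ∀ t₀ ∈ openInterval α β, ∀ᶠ x in l, t₀ < T x) : Tendsto T l (leftOf β) := by
  refine tendsto_comap_iff.2 (tendsto_nhdsWithin_iff.2
    ⟨tendsto_order.2 ⟨fun γ hγ => ?_, fun γ hγ => h1.mono fun x hx => hx.2.trans hγ⟩,
      h1.mono fun x hx => hx.2⟩)
  obtain ⟨t, h3, h4⟩ := EReal.lt_iff_exists_real_btwn.1 (max_lt hγ h)
  exact (h2 t ⟨(le_max_right _ _).trans_lt h3, h4⟩).mono fun x hx =>
    ((le_max_left _ _).trans_lt h3).trans (EReal.coe_lt_coe_iff.2 hx)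

/-- Global inverse function theorem for a function with negative derivative. -/
theorem exists_inverse_of_deriv_neg {I : Set ℝ} (hI : IsOpen I) (hI' : I.OrdConnected)
    {u u' : ℝ → ℝ} (hu : ∀ t ∈ I, HasDerivAt u (u' t) t) (hneg : ∀ t ∈ I, u' t < 0) :
    StrictAntiOn u I ∧ IsOpen (u '' I) ∧ (u '' I).OrdConnected ∧
    ∃ T : ℝ → ℝ, (∀ x ∈ u '' I, T x ∈ I ∧ u (T x) = x ∧ HasDerivAt T (u' (T x))⁻¹ x) ∧
      ∀ t ∈ I, T (u t) = t := by
  have huc : ContinuousOn u I := fun t ht => (hu t ht).continuousAt.continuousWithinAt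
  have hanti : StrictAntiOn u I := by
    refine strictAntiOn_of_deriv_neg hI'.convex huc fun t ht => ?_
    have ht := interior_subset ht
    rw [(hu t ht).deriv]; exact hneg t ht
  have hconn : IsPreconnected I := isPreconnected_iff_ordConnected.2 hI'
  have hopen : IsOpen (u '' I) := by
    refine isOpen_iff_mem_nhds.2 ?_
    rintro _ ⟨t, ht, rfl⟩
    obtain ⟨l, r, hlr, hsub⟩ := mem_nhds_iff_exists_Ioo_subset.1 (hI.mem_nhds ht)
    have h1 : (l + t) / 2 ∈ I := hsub ⟨by linarith [hlr.1], by linarith [hlr.1, hlr.2]⟩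
    have h2 : (t + r) / 2 ∈ I := hsub ⟨by linarith [hlr.1, hlr.2], by linarith [hlr.2]⟩
    exact mem_of_superset (Icc_mem_nhds (hanti ht h2 (by linarith [hlr.2]))
      (hanti h1 ht (by linarith [hlr.1]))) (hconn.intermediate_value h2 h1 huc)
  refine ⟨hanti, hopen, (hconn.image u huc).ordConnected, Function.invFunOn u I, ?_, ?_⟩
  swap
  · exact fun t ht => hanti.injOn.leftInvOn_invFunOn ht
  set T := Function.invFunOn u I with hT
  have hTI : ∀ x ∈ u '' I, T x ∈ I := fun x hx => Function.invFunOn_mem hx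
  have huT : ∀ x ∈ u '' I, u (T x) = x := fun x hx => Function.invFunOn_eq hx
  have hTu : ∀ t ∈ I, T (u t) = t := fun t ht => hanti.injOn.leftInvOn_invFunOn ht
  refine fun x hx => ⟨hTI x hx, huT x hx, ?_⟩
  -- Continuity of `T` comes from monotonicity and a large enough image; the sign turns `T` into an
  -- increasing function.
  have hmono : StrictMonoOn (fun y => -T y) (u '' I) := by
    intro y hy z hz hyz
    rw [← huT y hy, ← huT z hz] at hyz
    exact neg_lt_neg ((hanti.lt_iff_gt (hTI y hy) (hTI z hz)).1 hyz)
  have hTc : ContinuousAt T x := by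
    have : ContinuousAt (fun y => -T y) x := by
      refine hmono.continuousAt_of_image_mem_nhds (hopen.mem_nhds hx) ?_
      have h1 : (fun t : ℝ => -t) ⁻¹' I ∈ 𝓝 (-T x) :=
        (hI.preimage continuous_neg).mem_nhds (by simpa using hTI x hx)
      refine mem_of_superset h1 fun t ht => ⟨u (-t), ⟨-t, ht, rfl⟩, ?_⟩
      simp only
      rw [hTu _ ht, neg_neg]
    exact (this.neg).congr (Eventually.of_forall fun y => neg_neg (T y))
  exact (hu _ (hTI x hx)).of_local_left_inverse hTc (hneg _ (hTI x hx)).ne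
    (by filter_upwards [hopen.mem_nhds hx] with y hy using huT y hy)

/-! ### From travelling waves to profiles. -/

theorem eventually_left_pos_of_deriv_neg {φ : ℝ → ℝ} {D t : ℝ} (h : HasDerivAt φ D t)
    (hD : D < 0) (h0 : φ t = 0) : ∀ᶠ s in 𝓝[<] t, 0 < φ s := by
  have h1 := (hasDerivAt_iff_tendsto_slope.1 h).mono_left
    (nhdsWithin_mono t fun s (hs : s < t) => hs.ne)
  filter_upwards [h1.eventually (eventually_lt_nhds hD), self_mem_nhdsWithin] with s hs hst
  have hst : s < t := hst
  rw [slope_def_field, h0, sub_zero, div_lt_iff_of_neg (by linarith)] at hs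
  linarith

/-- With `s = |u'|` this turns the singular term `ρ d^r w^(-r)` into `ρ / s`. -/
theorem neg_rpow_flux {p d s : ℝ} (hp : 1 < p) (hd : 0 < d) (hs : 0 < s) :
    (d * s ^ (p - 2) * s) ^ (-(1 / (p - 1))) = (d ^ (1 / (p - 1)))⁻¹ * s⁻¹ := by
  have h1 : s ^ (p - 2) * s = s ^ (p - 1) := by
    rw [← Real.rpow_add_one hs.ne']; ring_nf
  have h2 : p - 1 ≠ 0 := by linarith
  rw [mul_assoc, h1, Real.mul_rpow hd.le (by positivity), ← Real.rpow_mul hs.le,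
    Real.rpow_neg hd.le, show (p - 1) * -(1 / (p - 1)) = -1 by field_simp, Real.rpow_neg_one]

section TravellingWave

variable {p c : ℝ} {f g d ρ u : ℝ → ℝ} {α β : EReal}

theorem IsTravellingWave.hasDerivAt_flux (hu : IsTravellingWave p f g d ρ c α β u) {t : ℝ}
    (ht : t ∈ openInterval α β) : HasDerivAt (flux p d u) (deriv (flux p d u) t) t :=
  ((hu.contDiffOn_flux.differentiableOn one_ne_zero).differentiableAt
    ((isOpen_openInterval α β).mem_nhds ht)).hasDerivAt

theorem IsTravellingWave.hasDerivAt (hu : IsTravellingWave p f g d ρ c α β u) {t : ℝ}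
    (ht : t ∈ openInterval α β) : HasDerivAt u (deriv u t) t :=
  ((hu.contDiffOn.differentiableOn one_ne_zero).differentiableAt
    ((isOpen_openInterval α β).mem_nhds ht)).hasDerivAt

/-- Where the flux vanishes, the equation gives it the slope `-ρ < 0`, so once nonpositive it is
negative ever after. If it were nonnegative at `t`, then `u' > 0` at all earlier times, and `u(α⁺) =
1` would force `u ≥ 1` there. -/
theorem IsTravellingWave.flux_neg (hu : IsTravellingWave p f g d ρ c α β u)
    (hρ : ∀ u ∈ Ioo (0 : ℝ) 1, 0 < ρ u) (hd : ∀ u ∈ Ioo (0 : ℝ) 1, 0 < d u) :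
    ∀ t ∈ openInterval α β, flux p d u t < 0 := by
  have hoc := ordConnected_openInterval α β
  have hzero : ∀ t ∈ openInterval α β, flux p d u t = 0 → deriv (flux p d u) t < 0 := by
    intro t ht h0
    have h1 : deriv u t = 0 := by
      by_contra hne
      have := mul_ne_zero (mul_ne_zero (hd _ (hu.mem_Ioo t ht)).ne'
        (Real.rpow_pos_of_pos (abs_pos.2 hne) (p - 2)).ne') hne
      exact this h0
    have := hu.equation t ht
    rw [h1, mul_zero, add_zero] at this
    linarith [hρ _ (hu.mem_Ioo t ht)]
  have hprop : ∀ s ∈ openInterval α β, ∀ t ∈ openInterval α β, s < t → flux p d u s ≤ 0 →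
      flux p d u t < 0 := by
    intro s hs t ht hst h0
    have hsub : Icc s t ⊆ openInterval α β := hoc.out hs ht
    have hle : ∀ ⦃x⦄, x ∈ Icc s t → flux p d u x ≤ 0 := by
      refine image_le_of_deriv_right_lt_deriv_boundary (f' := deriv (flux p d u))
        (B := fun _ => 0) (B' := fun _ => 0)
        (fun x hx => (hu.hasDerivAt_flux (hsub hx)).continuousAt.continuousWithinAt)
        (fun x hx => (hu.hasDerivAt_flux (hsub (Ico_subset_Icc_self hx))).hasDerivWithinAt)
        h0 (fun x => hasDerivAt_const x 0) fun x hx h => hzero x (hsub (Ico_subset_Icc_self hx)) h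
    refine lt_of_le_of_ne (hle ⟨hst.le, le_rfl⟩) fun h => ?_
    obtain ⟨y, h1, h2⟩ := ((eventually_left_pos_of_deriv_neg (hu.hasDerivAt_flux ht)
      (hzero t ht h) h).and (Ioo_mem_nhdsLT hst)).exists
    exact h1.not_ge (hle (Ioo_subset_Icc_self h2))
  intro t ht
  by_contra! hpos
  have hpos' : ∀ s ∈ openInterval α β, s < t → 0 < deriv u s := by
    intro s hs hst
    by_contra! h
    refine hpos.not_gt (hprop s hs t ht hst ?_)
    exact mul_nonpos_of_nonneg_of_nonpos (mul_nonneg (hd _ (hu.mem_Ioo s hs)).le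
      (Real.rpow_nonneg (abs_nonneg _) _)) h
  have hmono : MonotoneOn u (openInterval α t) := by
    have hsub : ∀ s ∈ openInterval α t, s ∈ openInterval α β ∧ s < t := fun s hs =>
      ⟨⟨hs.1, hs.2.trans ht.2⟩, EReal.coe_lt_coe_iff.1 hs.2⟩
    refine monotoneOn_of_deriv_nonneg (ordConnected_openInterval _ _).convex
      (fun s hs => (hu.hasDerivAt (hsub s hs).1).continuousAt.continuousWithinAt)
      (fun s hs => ?_) fun s hs => ?_
    · exact (hu.hasDerivAt (hsub s (interior_subset hs)).1).differentiableAt.differentiableWithinAt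
    · exact (hpos' s (hsub s (interior_subset hs)).1 (hsub s (interior_subset hs)).2).le
  obtain ⟨s, h1, h2⟩ := EReal.lt_iff_exists_real_btwn.1 ht.1
  have := rightOf_neBot hu.lt
  have hle : 1 ≤ u s := le_of_tendsto hu.tendsto_left (by
    filter_upwards [eventually_rightOf_mem ht.1, eventually_rightOf_lt h1] with y hy hys
    exact hmono hy ⟨h1, h2⟩ hys.le)
  exact hle.not_gt (hu.mem_Ioo s ⟨h1, h2.trans ht.2⟩).2

/-- The profile is minus the flux at time `T x`, with `T` the inverse of `u`. As `u` decreases, `x →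
0` corresponds to `t → β` and `x → 1` to `t → α`. -/
theorem IsTravellingWave.exists_isProfile (hp : 1 < p)
    (hu : IsTravellingWave p f g d ρ c α β u)
    (hρ : ∀ u ∈ Ioo (0 : ℝ) 1, 0 < ρ u) (hd : ∀ u ∈ Ioo (0 : ℝ) 1, 0 < d u) :
    ∃ w : ℝ → ℝ, IsProfile (1 / (p - 1)) (fun x => c * g x - f x)
      (fun x => ρ x * d x ^ (1 / (p - 1))) w ∧
      Tendsto w (𝓝[>] 0) (𝓝 0) ∧ Tendsto w (𝓝[<] 1) (𝓝 0) := by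
  have hφ := hu.flux_neg hρ hd
  have hneg : ∀ t ∈ openInterval α β, deriv u t < 0 := by
    intro t ht
    by_contra! h
    exact (hφ t ht).not_ge (mul_nonneg (mul_nonneg (hd _ (hu.mem_Ioo t ht)).le
      (Real.rpow_nonneg (abs_nonneg _) _)) h)
  have hI := isOpen_openInterval α β
  obtain ⟨hanti, -, hoc, T, hT, hTu⟩ := exists_inverse_of_deriv_neg hI
    (ordConnected_openInterval α β) (fun t ht => hu.hasDerivAt ht) hneg
  have := rightOf_neBot hu.lt
  have := leftOf_neBot hu.lt
  have himg : u '' openInterval α β = Ioo 0 1 := by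
    refine Subset.antisymm (image_subset_iff.2 hu.mem_Ioo) fun x hx => ?_
    obtain ⟨t₁, h1, h1'⟩ := ((hu.tendsto_left.eventually (eventually_gt_nhds hx.2)).and
      (eventually_rightOf_mem hu.lt)).exists
    obtain ⟨t₂, h2, h2'⟩ := ((hu.tendsto_right.eventually (eventually_lt_nhds hx.1)).and
      (eventually_leftOf_mem hu.lt)).exists
    exact hoc.out ⟨t₂, h2', rfl⟩ ⟨t₁, h1', rfl⟩ ⟨h2.le, h1.le⟩
  rw [himg] at hT
  refine ⟨fun x => -flux p d u (T x), fun x hx => ?_, ?_, ?_⟩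
  · obtain ⟨h1, h2, h3⟩ := hT x hx
    refine ⟨neg_pos.2 (hφ _ h1), ?_⟩
    convert! ((hu.hasDerivAt_flux h1).comp x h3).neg using 1
    have hs : 0 < -deriv u (T x) := neg_pos.2 (hneg _ h1)
    have hdx := Real.rpow_pos_of_pos (hd x hx) (1 / (p - 1))
    have e : -flux p d u (T x) = d x * (-deriv u (T x)) ^ (p - 2) * (-deriv u (T x)) := by
      rw [flux, h2, abs_of_neg (hneg _ h1)]; ring
    have heq := hu.equation _ h1
    rw [h2] at heq
    have hd' : deriv (flux p d u) (T x) = -(c * g x - f x) * deriv u (T x) - ρ x := by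
      linarith
    beta_reduce
    rw [e, neg_rpow_flux hp (hd x hx) hs, hd']
    have hne : deriv u (T x) ≠ 0 := (hneg _ h1).ne
    field_simp
    ring
  · have hTl : Tendsto T (𝓝[>] 0) (leftOf β) := by
      refine tendsto_leftOf hu.lt ?_ fun t₀ ht₀ => ?_
      · filter_upwards [Ioo_mem_nhdsGT zero_lt_one] with x hx using (hT x hx).1
      · filter_upwards [Ioo_mem_nhdsGT (hu.mem_Ioo t₀ ht₀).1] with x hx
        have hx1 : x ∈ Ioo (0 : ℝ) 1 := ⟨hx.1, hx.2.trans (hu.mem_Ioo t₀ ht₀).2⟩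
        rw [← hanti.lt_iff_gt (hT x hx1).1 ht₀, (hT x hx1).2.1]
        exact hx.2
    simpa using (hu.flux_right.comp hTl).neg
  · have hTl : Tendsto T (𝓝[<] 1) (rightOf α) := by
      refine tendsto_rightOf hu.lt ?_ fun t₀ ht₀ => ?_
      · filter_upwards [Ioo_mem_nhdsLT zero_lt_one] with x hx using (hT x hx).1
      · filter_upwards [Ioo_mem_nhdsLT (hu.mem_Ioo t₀ ht₀).2] with x hx
        have hx1 : x ∈ Ioo (0 : ℝ) 1 := ⟨(hu.mem_Ioo t₀ ht₀).1.trans hx.1, hx.2⟩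
        rw [← hanti.lt_iff_gt ht₀ (hT x hx1).1, (hT x hx1).2.1]
        exact hx.1
    simpa using (hu.flux_left.comp hTl).neg

end TravellingWave

/-! ### From profiles to travelling waves. -/

/-- The speed of descent at height `x` must be `v = (w/d)^r`, so the time at height `x` is `-∫ 1/v`,
and `u` is the inverse of this function. The base point `1/2` only fixes a translation; `α` and `β`
are the infimum and supremum of the times, finite or not. -/
theorem admissibleSpeed_of_isProfile {p c : ℝ} {f g d ρ w : ℝ → ℝ} (hp : 1 < p)
    (hf : ContinuousOn f (Icc 0 1)) (hg : ContinuousOn g (Icc 0 1))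
    (hρc : ContinuousOn ρ (Icc 0 1)) (hdc : ContinuousOn d (Ioo 0 1))
    (hd : ∀ u ∈ Ioo (0 : ℝ) 1, 0 < d u)
    (hw : IsProfile (1 / (p - 1)) (fun x => c * g x - f x)
      (fun x => ρ x * d x ^ (1 / (p - 1))) w)
    (hw0 : Tendsto w (𝓝[>] 0) (𝓝 0)) (hw1 : Tendsto w (𝓝[<] 1) (𝓝 0)) :
    AdmissibleSpeed p f g d ρ c := by
  have hp1 : p - 1 ≠ 0 := by linarith
  set r := 1 / (p - 1) with hr
  set v : ℝ → ℝ := fun x => (w x / d x) ^ r with hv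
  have hvpos : ∀ x ∈ Ioo (0 : ℝ) 1, 0 < v x := fun x hx =>
    Real.rpow_pos_of_pos (div_pos (hw x hx).1 (hd x hx)) _
  have hvc : ContinuousOn v (Ioo 0 1) :=
    (hw.isSubprofile.continuousOn.div hdc fun x hx => (hd x hx).ne').rpow_const fun x hx =>
      Or.inl (div_pos (hw x hx).1 (hd x hx)).ne'
  have hvic : ContinuousOn (fun x => -(v x)⁻¹) (Ioo 0 1) :=
    (hvc.inv₀ fun x hx => (hvpos x hx).ne').neg
  set T : ℝ → ℝ := fun x => ∫ y in (1 / 2 : ℝ)..x, -(v y)⁻¹ with hTdef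
  have hT : ∀ x ∈ Ioo (0 : ℝ) 1, HasDerivAt T (-(v x)⁻¹) x := by
    intro x hx
    have hsub : uIcc (1 / 2 : ℝ) x ⊆ Ioo 0 1 := ordConnected_Ioo.uIcc_subset (by norm_num) hx
    have hca : ∀ y ∈ Ioo (0 : ℝ) 1, ContinuousAt (fun x => -(v x)⁻¹) y := fun y hy =>
      hvic.continuousAt (Ioo_mem_nhds hy.1 hy.2)
    exact intervalIntegral.integral_hasDerivAt_right (hvic.mono hsub).intervalIntegrable
      (ContinuousAt.stronglyMeasurableAtFilter isOpen_Ioo hca x hx) (hca x hx)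
  obtain ⟨hanti, hJ, hJoc, u, hu, huT⟩ := exists_inverse_of_deriv_neg isOpen_Ioo ordConnected_Ioo
    hT (fun x hx => neg_neg_of_pos (inv_pos.2 (hvpos x hx)))
  set J := T '' Ioo 0 1 with hJdef
  set α : EReal := sInf ((fun t : ℝ => (t : EReal)) '' J) with hα
  set β : EReal := sSup ((fun t : ℝ => (t : EReal)) '' J) with hβ
  have hαT : ∀ x ∈ Ioo (0 : ℝ) 1, α < T x := by
    intro x hx
    have hy : (x + 1) / 2 ∈ Ioo (0 : ℝ) 1 := ⟨by linarith [hx.1], by linarith [hx.2]⟩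
    exact (sInf_le (mem_image_of_mem _ (mem_image_of_mem T hy))).trans_lt
      (EReal.coe_lt_coe_iff.2 (hanti hx hy (by linarith [hx.2])))
  have hTβ : ∀ x ∈ Ioo (0 : ℝ) 1, (T x : EReal) < β := by
    intro x hx
    have hy : x / 2 ∈ Ioo (0 : ℝ) 1 := ⟨by linarith [hx.1], by linarith [hx.1, hx.2]⟩
    exact (EReal.coe_lt_coe_iff.2 (hanti hy hx (by linarith [hx.1]))).trans_le
      (le_sSup (mem_image_of_mem _ (mem_image_of_mem T hy)))
  have hIJ : openInterval α β = J := by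
    refine Subset.antisymm (fun t ht => ?_) ?_
    · obtain ⟨_, ⟨a, ha, rfl⟩, h1⟩ := sInf_lt_iff.1 ht.1
      obtain ⟨_, ⟨b, hb, rfl⟩, h2⟩ := lt_sSup_iff.1 ht.2
      exact hJoc.out ha hb ⟨(EReal.coe_lt_coe_iff.1 h1).le, (EReal.coe_lt_coe_iff.1 h2).le⟩
    · rintro _ ⟨x, hx, rfl⟩
      exact ⟨hαT x hx, hTβ x hx⟩
  have hhalf : (1 / 2 : ℝ) ∈ Ioo (0 : ℝ) 1 := by norm_num
  have hαβ : α < β := (hαT _ hhalf).trans (hTβ _ hhalf)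
  have hud : ∀ t ∈ J, HasDerivAt u (-v (u t)) t := by
    intro t ht
    have := (hu t ht).2.2
    rwa [inv_neg, inv_inv] at this
  have huc : ContinuousOn u J := fun t ht => (hud t ht).continuousAt.continuousWithinAt
  have humaps : MapsTo u J (Ioo 0 1) := fun t ht => (hu t ht).1
  have hflux : ∀ t ∈ J, flux p d u t = -w (u t) := by
    intro t ht
    have hx := (hu t ht).1
    have hz := div_pos (hw _ hx).1 (hd _ hx)
    have h1 : v (u t) ^ (p - 2) * v (u t) = w (u t) / d (u t) := by
      rw [← Real.rpow_add_one (hvpos _ hx).ne', hv]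
      simp only
      rw [← Real.rpow_mul hz.le, show r * (p - 2 + 1) = 1 by rw [hr]; field_simp; ring,
        Real.rpow_one]
    rw [flux, (hud t ht).deriv, abs_neg, abs_of_pos (hvpos _ hx), mul_neg, mul_assoc, h1,
      mul_div_cancel₀ _ (hd _ hx).ne']
  have hfluxd : ∀ t ∈ J, HasDerivAt (flux p d u)
      (-(((c * g (u t) - f (u t)) - ρ (u t) * d (u t) ^ r * w (u t) ^ (-r)) * -v (u t))) t := by
    intro t ht
    have h1 := ((hw _ (hu t ht).1).2.comp t (hud t ht)).neg
    refine h1.congr_of_eventuallyEq ?_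
    filter_upwards [hJ.mem_nhds ht] with s hs using hflux s hs
  have hC1 : ∀ F F' : ℝ → ℝ, (∀ t ∈ J, HasDerivAt F (F' t) t) → ContinuousOn F' J →
      ContDiffOn ℝ 1 F J := by
    intro F F' hF hF'
    have := (contDiffOn_succ_iff_deriv_of_isOpen (n := 0) (𝕜 := ℝ) (f := F) hJ).2
      ⟨fun t ht => (hF t ht).differentiableAt.differentiableWithinAt, by simp,
        contDiffOn_zero.2 (hF'.congr fun t ht => (hF t ht).deriv)⟩
    simpa using this
  have huR : Tendsto u (rightOf α) (𝓝[<] 1) := by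
    refine tendsto_nhdsWithin_iff.2 ⟨tendsto_order.2 ⟨fun x₀ hx₀ => ?_, fun x₀ hx₀ => ?_⟩, ?_⟩
    · have hx1 : max x₀ (1 / 2) ∈ Ioo (0 : ℝ) 1 :=
        ⟨lt_max_of_lt_right (by norm_num), max_lt hx₀ (by norm_num)⟩
      filter_upwards [eventually_rightOf_mem hαβ, eventually_rightOf_lt (hαT _ hx1)] with t ht htx
      rw [hIJ] at ht
      rw [← (hu t ht).2.1, hanti.lt_iff_gt (hu t ht).1 hx1] at htx
      exact (le_max_left _ _).trans_lt htx
    · filter_upwards [eventually_rightOf_mem hαβ] with t ht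
      rw [hIJ] at ht
      exact (hu t ht).1.2.trans hx₀
    · filter_upwards [eventually_rightOf_mem hαβ] with t ht
      rw [hIJ] at ht
      exact (hu t ht).1.2
  have huL : Tendsto u (leftOf β) (𝓝[>] 0) := by
    refine tendsto_nhdsWithin_iff.2 ⟨tendsto_order.2 ⟨fun x₀ hx₀ => ?_, fun x₀ hx₀ => ?_⟩, ?_⟩
    · filter_upwards [eventually_leftOf_mem hαβ] with t ht
      rw [hIJ] at ht
      exact hx₀.trans (hu t ht).1.1
    · have hx1 : min x₀ (1 / 2) ∈ Ioo (0 : ℝ) 1 :=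
        ⟨lt_min hx₀ (by norm_num), min_lt_of_right_lt (by norm_num)⟩
      filter_upwards [eventually_leftOf_mem hαβ, eventually_leftOf_gt (hTβ _ hx1)] with t ht htx
      rw [hIJ] at ht
      rw [← (hu t ht).2.1, hanti.lt_iff_gt hx1 (hu t ht).1] at htx
      exact htx.trans_le (min_le_left _ _)
    · filter_upwards [eventually_leftOf_mem hαβ] with t ht
      rw [hIJ] at ht
      exact (hu t ht).1.1
  refine ⟨α, β, u, hαβ, ?_, ?_, ?_, ?_, huR.mono_right nhdsWithin_le_nhds,
    huL.mono_right nhdsWithin_le_nhds, ?_, ?_⟩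
  · rw [hIJ]
    exact hC1 _ _ hud (hvc.comp huc humaps).neg
  · rw [hIJ]; exact humaps
  · rw [hIJ]
    refine hC1 _ _ hfluxd (ContinuousOn.neg (ContinuousOn.mul ?_ (hvc.comp huc humaps).neg))
    refine ContinuousOn.comp (g := fun x => c * g x - f x - ρ x * d x ^ r * w x ^ (-r)) ?_ huc
      humaps
    have hs : Ioo (0 : ℝ) 1 ⊆ Icc 0 1 := Ioo_subset_Icc_self
    exact ((continuousOn_const.mul (hg.mono hs)).sub (hf.mono hs)).sub
      (((hρc.mono hs).mul (hdc.rpow_const fun x hx => Or.inl (hd x hx).ne')).mul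
        (hw.isSubprofile.continuousOn.rpow_const fun x hx => Or.inl (hw x hx).1.ne'))
  · rw [hIJ]
    intro t ht
    have hx := (hu t ht).1
    have hwx := (hw _ hx).1
    have hdx := hd _ hx
    rw [(hfluxd t ht).deriv, (hud t ht).deriv]
    have h1 : d (u t) ^ r * w (u t) ^ (-r) * v (u t) = 1 := by
      simp only [hv]
      rw [Real.div_rpow hwx.le hdx.le, Real.rpow_neg hwx.le]
      have := (Real.rpow_pos_of_pos hwx r).ne'
      have := (Real.rpow_pos_of_pos hdx r).ne'
      field_simp
    linear_combination (-ρ (u t)) * h1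
  · have := (hw1.comp huR).neg
    rw [neg_zero] at this
    refine this.congr' ?_
    filter_upwards [eventually_rightOf_mem hαβ] with t ht
    rw [hIJ] at ht
    exact (hflux t ht).symm
  · have := (hw0.comp huL).neg
    rw [neg_zero] at this
    refine this.congr' ?_
    filter_upwards [eventually_leftOf_mem hαβ] with t ht
    rw [hIJ] at ht
    exact (hflux t ht).symm

/-! ### Primitives and integrated inequalities. -/

theorem hasDerivAt_primitive {φ : ℝ → ℝ} (hc : ContinuousOn φ (Ioo 0 1))
    (hi : IntegrableOn φ (Ioo 0 1)) {x : ℝ} (hx : x ∈ Ioo (0 : ℝ) 1) :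
    HasDerivAt (fun x => ∫ t in (0 : ℝ)..x, φ t) (φ x) x := by
  have hca : ∀ y ∈ Ioo (0 : ℝ) 1, ContinuousAt φ y := fun y hy =>
    hc.continuousAt (Ioo_mem_nhds hy.1 hy.2)
  refine intervalIntegral.integral_hasDerivAt_right ?_
    (ContinuousAt.stronglyMeasurableAtFilter isOpen_Ioo hca x hx) (hca x hx)
  rw [intervalIntegrable_iff_integrableOn_Ioo_of_le hx.1.le]
  exact hi.mono_set (Ioo_subset_Ioo_right hx.2.le)

theorem continuousOn_primitive_Ioo {φ : ℝ → ℝ} (hi : IntegrableOn φ (Ioo 0 1)) :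
    ContinuousOn (fun x => ∫ t in (0 : ℝ)..x, φ t) (Icc 0 1) := by
  have hi' : IntervalIntegrable φ volume 0 1 := by
    rwa [intervalIntegrable_iff_integrableOn_Ioo_of_le zero_le_one]
  have := intervalIntegral.continuousOn_primitive_interval' hi' (a := 0) (by simp)
  rwa [uIcc_of_le zero_le_one] at this

theorem tendsto_primitive_zero {φ : ℝ → ℝ} (hi : IntegrableOn φ (Ioo 0 1)) :
    Tendsto (fun x => ∫ t in (0 : ℝ)..x, φ t) (𝓝[>] 0) (𝓝 0) := by
  have h := continuousOn_primitive_Ioo hi 0 (by simp)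
  have h' : Tendsto (fun x => ∫ t in (0 : ℝ)..x, φ t) (𝓝[>] 0) (𝓝 (∫ t in (0 : ℝ)..0, φ t)) := by
    rw [← nhdsWithin_Ioo_eq_nhdsGT (zero_lt_one' ℝ)]
    exact h.mono_left (nhdsWithin_mono _ Ioo_subset_Icc_self)
  simpa using h'

theorem integrableOn_Ioo_of_continuousOn_Icc {φ : ℝ → ℝ} (hc : ContinuousOn φ (Icc 0 1)) :
    IntegrableOn φ (Ioo 0 1) :=
  hc.integrableOn_Icc.mono_set Ioo_subset_Icc_self

theorem nonneg_of_hasDerivAt_nonneg {δ : ℝ} {D D' : ℝ → ℝ}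
    (hD : ∀ x ∈ Ioo 0 δ, HasDerivAt D (D' x) x) (hD' : ∀ x ∈ Ioo 0 δ, 0 ≤ D' x)
    (h0 : Tendsto D (𝓝[>] 0) (𝓝 0)) : ∀ x ∈ Ioo 0 δ, 0 ≤ D x := by
  have hmono : MonotoneOn D (Ioo 0 δ) := by
    refine monotoneOn_of_deriv_nonneg (convex_Ioo _ _)
      (fun x hx => (hD x hx).continuousAt.continuousWithinAt) (fun x hx => ?_) fun x hx => ?_
    · exact (hD x (interior_subset hx)).differentiableAt.differentiableWithinAt
    · rw [(hD x (interior_subset hx)).deriv]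
      exact hD' x (interior_subset hx)
  intro x hx
  refine le_of_tendsto h0 ?_
  filter_upwards [Ioo_mem_nhdsGT hx.1] with y hy
  exact hmono ⟨hy.1, hy.2.trans hx.2⟩ hx hy.2.le

/-- `D` is nonnegative, so a zero would be an interior minimum, where the derivative cannot be
positive. -/
theorem pos_of_hasDerivAt_pos {δ : ℝ} {D D' : ℝ → ℝ}
    (hD : ∀ x ∈ Ioo 0 δ, HasDerivAt D (D' x) x) (hD' : ∀ x ∈ Ioo 0 δ, 0 < D' x)
    (h0 : Tendsto D (𝓝[>] 0) (𝓝 0)) : ∀ x ∈ Ioo 0 δ, 0 < D x := by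
  intro x hx
  have hnn := nonneg_of_hasDerivAt_nonneg hD (fun y hy => (hD' y hy).le) h0
  refine lt_of_le_of_ne (hnn x hx) fun h => (hD' x hx).ne' ?_
  refine IsLocalMin.hasDerivAt_eq_zero ?_ (hD x hx)
  filter_upwards [Ioo_mem_nhds hx.1 hx.2] with y hy
  rw [← h]
  exact hnn y hy

/-- The singular term is positive, so `w' < h`; integrate from `0`. -/
theorem IsProfile.lt_primitive {r : ℝ} {h q w : ℝ → ℝ} (hh : ContinuousOn h (Icc 0 1))
    (hq : ∀ x ∈ Ioo (0 : ℝ) 1, 0 < q x) (hw : IsProfile r h q w)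
    (hw0 : Tendsto w (𝓝[>] 0) (𝓝 0)) : ∀ x ∈ Ioo (0 : ℝ) 1, w x < ∫ t in (0 : ℝ)..x, h t := by
  intro x hx
  have hi := integrableOn_Ioo_of_continuousOn_Icc hh
  have := pos_of_hasDerivAt_pos (D := fun x => (∫ t in (0 : ℝ)..x, h t) - w x)
    (fun y hy => (hasDerivAt_primitive (hh.mono Ioo_subset_Icc_self) hi hy).sub (hw y hy).2)
    (fun y hy => by
      have := mul_pos (hq y hy) (Real.rpow_pos_of_pos (hw y hy).1 (-r))
      linarith)
    (by simpa using (tendsto_primitive_zero hi).sub hw0) x hx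
  linarith

/-! ### Existence through subsolutions, and large speeds. -/

/-- The profile vanishing at `1` is squeezed between `0` and `v`, hence also vanishes at `0`. -/
theorem exists_isProfile_of_isSubprofile {r : ℝ} {h q v : ℝ → ℝ} (hr : 0 < r)
    (hh : ContinuousOn h (Icc 0 1)) (hqc : ContinuousOn q (Ioo 0 1))
    (hq : ∀ x ∈ Ioo (0 : ℝ) 1, 0 < q x) (hqi : IntegrableOn q (Ioo 0 1))
    (hv : IsSubprofile r h q v) (hv0 : Tendsto v (𝓝[>] 0) (𝓝 0)) :
    ∃ w : ℝ → ℝ, IsProfile r h q w ∧ Tendsto w (𝓝[>] 0) (𝓝 0) ∧ Tendsto w (𝓝[<] 1) (𝓝 0) := by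
  obtain ⟨w, hw, hw1⟩ := exists_isProfile_tendsto_one hr hh hqc hq hqi
  refine ⟨w, hw, ?_, hw1⟩
  refine tendsto_of_tendsto_of_tendsto_of_le_of_le' tendsto_const_nhds hv0 ?_ ?_
  · filter_upwards [Ioo_mem_nhdsGT zero_lt_one] with x hx using (hw x hx).1.le
  · filter_upwards [Ioo_mem_nhdsGT zero_lt_one] with x hx
    exact hw.le_of_isSubprofile hr hq hw1 hv x hx

/-- Adding `E ≥ 0` weakens the singular term, so only the slope of `E` has to pay for the change of
speed. The speed may go up or down. -/
theorem IsSubprofile.of_le {r c c' : ℝ} {f g q w E E' : ℝ → ℝ} (hr : 0 < r)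
    (hq : ∀ x ∈ Ioo (0 : ℝ) 1, 0 < q x) (hw : IsProfile r (fun x => c * g x - f x) q w)
    (hE : ∀ x ∈ Ioo (0 : ℝ) 1, HasDerivAt E (E' x) x) (hE0 : ∀ x ∈ Ioo (0 : ℝ) 1, 0 ≤ E x)
    (hE' : ∀ x ∈ Ioo (0 : ℝ) 1, E' x ≤ (c' - c) * g x) :
    IsSubprofile r (fun x => c' * g x - f x) q (fun x => w x + E x) := by
  intro x hx
  have h0 := (hw x hx).1
  have hle : w x ≤ w x + E x := le_add_of_nonneg_right (hE0 x hx)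
  refine ⟨h0.trans_le hle, _, (hw x hx).2.add (hE x hx), ?_⟩
  have := mul_le_mul_of_nonneg_left
    (Real.rpow_le_rpow_of_nonpos h0 hle (neg_nonpos.2 hr.le)) (hq x hx).le
  have := hE' x hx
  linarith

/-- For large speeds there is a subsolution vanishing at `0`. -/
theorem exists_isSubprofile_of_large {r l₀ : ℝ} {f g q : ℝ → ℝ} (hr : 0 < r)
    (hf : ContinuousOn f (Icc 0 1)) (hg : ContinuousOn g (Icc 0 1))
    (hqc : ContinuousOn q (Ioo 0 1)) (hq : ∀ x ∈ Ioo (0 : ℝ) 1, 0 < q x)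
    (hqi : IntegrableOn q (Ioo 0 1)) (hg0 : 0 < g 0)
    (hG : ∀ u ∈ Ioc (0 : ℝ) 1, 0 < ∫ s in (0 : ℝ)..u, g s)
    (hl : Tendsto (fun x => q x / x ^ r) (𝓝[>] 0) (𝓝 l₀)) :
    ∃ (c : ℝ) (v : ℝ → ℝ), IsSubprofile r (fun x => c * g x - f x) q v ∧
      Tendsto v (𝓝[>] 0) (𝓝 0) := by
  have hfi := integrableOn_Ioo_of_continuousOn_Icc hf
  have hgi := integrableOn_Ioo_of_continuousOn_Icc hg
  have hfo := hf.mono (Ioo_subset_Icc_self (a := (0 : ℝ)) (b := 1))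
  have hgo := hg.mono (Ioo_subset_Icc_self (a := (0 : ℝ)) (b := 1))
  set C := l₀ + 1 with hC
  have hg' : Tendsto g (𝓝[>] 0) (𝓝 (g 0)) := by
    rw [← nhdsWithin_Ioo_eq_nhdsGT (zero_lt_one' ℝ)]
    exact (hg 0 (by simp)).mono_left (nhdsWithin_mono _ Ioo_subset_Icc_self)
  obtain ⟨δ, hδ, hsub⟩ := (mem_nhdsGT_iff_exists_Ioo_subset' zero_lt_one).1
    (((hl.eventually (eventually_lt_nhds (lt_add_one l₀))).and
    (hg'.eventually (eventually_gt_nhds (half_lt_self hg0)))).and (Ioo_mem_nhdsGT zero_lt_one))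
  have hδ : 0 < δ := hδ
  have hsub' : ∀ x ∈ Ioo 0 δ, x ∈ Ioo (0 : ℝ) 1 ∧ q x ≤ C * x ^ r ∧ g 0 / 2 ≤ g x := by
    intro x hx
    obtain ⟨⟨h1, h2⟩, h3⟩ := hsub hx
    exact ⟨h3, ((div_lt_iff₀ (Real.rpow_pos_of_pos hx.1 _)).1 h1).le, le_of_lt h2⟩
  obtain ⟨y, hy⟩ := nonempty_Ioo.2 hδ
  have hC0 : 0 < C := by
    by_contra! h
    have h1 := (hsub' y hy).2.1
    have h2 := mul_nonpos_of_nonpos_of_nonneg h (Real.rpow_nonneg hy.1.le r)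
    linarith [hq y (hsub' y hy).1]
  set e := min δ 1 / 2 with he
  have hm0 : 0 < min δ 1 := lt_min hδ one_pos
  have he0 : 0 < e := by positivity
  have he1 : e < 1 := by linarith [min_le_right δ 1]
  have heδ : e < δ := by linarith [min_le_left δ 1]
  have hGc := continuousOn_primitive_Ioo hgi
  obtain ⟨x₀, hx₀, hmin⟩ := isCompact_Icc.exists_isMinOn (nonempty_Icc.2 he1.le)
    (hGc.mono (Icc_subset_Icc_left he0.le))
  obtain ⟨M, hM⟩ := isCompact_Icc.exists_bound_of_continuousOn hf
  obtain ⟨K₁, hK₁⟩ := isCompact_Icc.exists_bound_of_continuousOn (continuousOn_primitive_Ioo hfi)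
  obtain ⟨K₂, hK₂⟩ := isCompact_Icc.exists_bound_of_continuousOn (continuousOn_primitive_Ioo hqi)
  have hm := hG x₀ ⟨he0.trans_le hx₀.1, hx₀.2⟩
  -- The first condition makes `v' ≥ 1`, hence `v x ≥ x`, near `0`; the second makes `v ≥ 1` on `[e,
  -- 1)`.
  obtain ⟨c, ⟨hc1, hc2⟩, hc0⟩ : ∃ c : ℝ, (M + 2 * C + 1 ≤ c * (g 0 / 2) ∧
      K₁ + C + K₂ + 1 ≤ c * ∫ s in (0 : ℝ)..x₀, g s) ∧ 0 < c :=
    ((((tendsto_id (α := ℝ) (x := atTop)).atTop_mul_const (half_pos hg0)).eventually_ge_atTop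
      (M + 2 * C + 1)).and ((((tendsto_id (α := ℝ) (x := atTop)).atTop_mul_const
        hm).eventually_ge_atTop (K₁ + C + K₂ + 1))) |>.and (eventually_gt_atTop 0)).exists
  set v : ℝ → ℝ := fun x => c * (∫ t in (0 : ℝ)..x, g t) - (∫ t in (0 : ℝ)..x, f t) - C * x -
    ∫ t in (0 : ℝ)..x, q t with hv
  have hvd : ∀ x ∈ Ioo (0 : ℝ) 1, HasDerivAt v (c * g x - f x - C - q x) x := by
    intro x hx
    have := ((((hasDerivAt_primitive hgo hgi hx).const_mul c).sub
      (hasDerivAt_primitive hfo hfi hx)).sub ((hasDerivAt_id x).const_mul C)).sub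
      (hasDerivAt_primitive hqc hqi hx)
    simpa using! this
  have hid : Tendsto (fun x : ℝ => x) (𝓝[>] 0) (𝓝 0) := nhdsWithin_le_nhds
  have hv0 : Tendsto v (𝓝[>] 0) (𝓝 0) := by
    have := ((((tendsto_primitive_zero hgi).const_mul c).sub (tendsto_primitive_zero hfi)).sub
      (hid.const_mul C)).sub (tendsto_primitive_zero hqi)
    simpa using this
  have hv1 : ∀ x ∈ Ioo 0 δ, x ≤ v x := by
    intro x hx
    have := nonneg_of_hasDerivAt_nonneg (δ := δ) (D := fun x => v x - x)
      (fun y hy => (hvd y (hsub' y hy).1).sub (hasDerivAt_id y)) (fun y hy => ?_)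
      (by simpa using hv0.sub hid) x hx
    · linarith
    obtain ⟨h1, h2, h3⟩ := hsub' y hy
    have h4 : q y ≤ C := h2.trans (mul_le_of_le_one_right hC0.le
      (Real.rpow_le_one h1.1.le h1.2.le hr.le))
    have h5 := (le_abs_self _).trans (hM y (Ioo_subset_Icc_self h1))
    have h6 := mul_le_mul_of_nonneg_left h3 hc0.le
    linarith
  have hv2 : ∀ x ∈ Ico e 1, 1 ≤ v x := by
    intro x hx
    have hx' : x ∈ Icc (0 : ℝ) 1 := ⟨he0.le.trans hx.1, hx.2.le⟩
    have h1 := (le_abs_self _).trans (hK₁ x hx')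
    have h2 := (le_abs_self _).trans (hK₂ x hx')
    have h3 := mul_le_mul_of_nonneg_left (isMinOn_iff.1 hmin x ⟨hx.1, hx.2.le⟩) hc0.le
    have h4 : C * x ≤ C := mul_le_of_le_one_right hC0.le hx.2.le
    simp only [hv]
    linarith
  refine ⟨c, v, fun x hx => ?_, hv0⟩
  -- Since `v' = h - C - q`, being a subsolution means `q v^(-r) ≤ C + q`. Near `0`, `v ≥ x` and `q
  -- ≤ C x^r` bound the left side by `C`; elsewhere `v ≥ 1` bounds it by `q`.
  have key : 0 < v x ∧ q x * v x ^ (-r) ≤ C + q x := by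
    rcases lt_or_ge x e with hxe | hxe
    · have hxδ : x ∈ Ioo 0 δ := ⟨hx.1, hxe.trans heδ⟩
      have h1 := hv1 x hxδ
      refine ⟨hx.1.trans_le h1, ?_⟩
      have hxr := Real.rpow_pos_of_pos hx.1 r
      calc q x * v x ^ (-r) ≤ q x * x ^ (-r) := mul_le_mul_of_nonneg_left
            (Real.rpow_le_rpow_of_nonpos hx.1 h1 (neg_nonpos.2 hr.le)) (hq x hx).le
        _ ≤ C := by
            rw [Real.rpow_neg hx.1.le, ← div_eq_mul_inv, div_le_iff₀ hxr]
            exact (hsub' x hxδ).2.1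
        _ ≤ C + q x := by linarith [hq x hx]
    · have h1 := hv2 x ⟨hxe, hx.2⟩
      refine ⟨by linarith, ?_⟩
      have := mul_le_mul_of_nonneg_left
        (Real.rpow_le_one_of_one_le_of_nonpos h1 (neg_nonpos.2 hr.le)) (hq x hx).le
      linarith
  exact ⟨key.1, _, hvd x hx, by linarith [key.2]⟩

/-! ### The sharp constant and the explicit criteria. -/

/-- The maximum of `(1 - t) ^ (p - 1) * t` on `(0, 1)`. -/
theorem one_sub_rpow_mul_le {p t : ℝ} (hp : 1 < p) (ht : t ∈ Ioo (0 : ℝ) 1) :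
    p ^ p / (p - 1) ^ (p - 1) * ((1 - t) ^ (p - 1) * t) ≤ 1 := by
  have hp0 : 0 < p := by linarith
  have hp1 : 0 < p - 1 := by linarith
  have ht1 : 0 < 1 - t := by linarith [ht.2]
  have ht0 := ht.1
  -- The two numbers are scaled to have weighted mean `1` and to coincide at the maximiser `t =
  -- 1/p`.
  have h := Real.geom_mean_le_arith_mean2_weighted (w₁ := (p - 1) / p) (w₂ := 1 / p)
    (p₁ := (1 - t) * p / (p - 1)) (p₂ := t * p) (by positivity) (by positivity) (by positivity)
    (by positivity) (by field_simp; ring)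
  have e1 : (p - 1) / p * ((1 - t) * p / (p - 1)) + 1 / p * (t * p) = 1 := by field_simp; ring
  rw [e1] at h
  have h2 := Real.rpow_le_one (by positivity) h hp0.le
  rw [Real.mul_rpow (by positivity) (by positivity), ← Real.rpow_mul (by positivity),
    ← Real.rpow_mul (by positivity), div_mul_cancel₀ _ hp0.ne', div_mul_cancel₀ _ hp0.ne',
    Real.rpow_one, Real.div_rpow (by positivity) hp1.le, Real.mul_rpow ht1.le hp0.le] at h2
  have e2 : p ^ p = p ^ (p - 1) * p := by
    rw [← Real.rpow_add_one hp0.ne']; ring_nf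
  rw [e2]
  calc _ = (1 - t) ^ (p - 1) * p ^ (p - 1) / (p - 1) ^ (p - 1) * (t * p) := by ring
    _ ≤ 1 := h2

theorem mul_rpow_rpow_inv {p a b : ℝ} (hp : 1 < p) (ha : 0 ≤ a) (hb : 0 ≤ b) :
    (a ^ (p - 1) * b) ^ (1 / (p - 1)) = a * b ^ (1 / (p - 1)) := by
  have hp1 : p - 1 ≠ 0 := by linarith
  rw [Real.mul_rpow (by positivity) hb, ← Real.rpow_mul ha, mul_one_div_cancel hp1, Real.rpow_one]

/-- For `v = H/p` the subsolution inequality reads `q p^r H^(-r) ≤ h (p-1)/p`, which is the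
`(p-1)`-th root of the hypothesis. -/
theorem isSubprofile_of_le {p : ℝ} {h d ρ : ℝ → ℝ} (hp : 1 < p) (hh : ContinuousOn h (Icc 0 1))
    (hρ : ∀ u ∈ Ioo (0 : ℝ) 1, 0 < ρ u) (hd : ∀ u ∈ Ioo (0 : ℝ) 1, 0 < d u)
    (hle : ∀ u ∈ Ioo (0 : ℝ) 1, 0 ≤ h u ∧
        p ^ p / (p - 1) ^ (p - 1) * d u * ρ u ^ (p - 1) ≤
          h u ^ (p - 1) * ∫ s in (0 : ℝ)..u, h s) :
    IsSubprofile (1 / (p - 1)) h (fun x => ρ x * d x ^ (1 / (p - 1)))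
      (fun x => (∫ s in (0 : ℝ)..x, h s) / p) := by
  intro x hx
  have hp0 : 0 < p := by linarith
  have hp1 : 0 < p - 1 := by linarith
  obtain ⟨h0, h1⟩ := hle x hx
  set H := ∫ s in (0 : ℝ)..x, h s with hH
  have hdx := hd x hx
  have hρx := hρ x hx
  have hHpos : 0 < H := by
    refine pos_of_mul_pos_right (lt_of_lt_of_le ?_ h1) (Real.rpow_nonneg h0 _)
    positivity
  refine ⟨div_pos hHpos hp0, _, (hasDerivAt_primitive (hh.mono Ioo_subset_Icc_self)
    (integrableOn_Ioo_of_continuousOn_Icc hh) hx).div_const p, ?_⟩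
  beta_reduce
  rw [← hH]
  set r := 1 / (p - 1) with hr
  have hr0 : 0 < r := by positivity
  have hK : (p ^ p / (p - 1) ^ (p - 1)) ^ r = p * p ^ r / (p - 1) := by
    rw [Real.div_rpow (by positivity) (by positivity), ← Real.rpow_mul hp0.le,
      ← Real.rpow_mul hp1.le, show (p - 1) * r = 1 by rw [hr]; field_simp,
      show p * r = 1 + r by rw [hr]; field_simp; ring, Real.rpow_add hp0, Real.rpow_one,
      Real.rpow_one]
  have h2 := Real.rpow_le_rpow (by positivity) h1 hr0.le
  rw [hr, mul_rpow_rpow_inv hp h0 hHpos.le, mul_comm (p ^ p / _ * d x),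
    mul_rpow_rpow_inv hp hρx.le (by positivity), ← hr,
    Real.mul_rpow (by positivity) hdx.le, hK] at h2
  have hHr := Real.rpow_pos_of_pos hHpos r
  have hpr := Real.rpow_pos_of_pos hp0 r
  have h3 : ρ x * d x ^ r * p ^ r ≤ h x * H ^ r * ((p - 1) / p) := by
    have h4 := mul_le_mul_of_nonneg_right h2 (show 0 ≤ (p - 1) / p by positivity)
    refine le_trans (le_of_eq ?_) h4
    field_simp
  rw [Real.rpow_neg (by positivity), Real.div_rpow hHpos.le hp0.le, inv_div]
  have h5 : ρ x * d x ^ r * (p ^ r / H ^ r) ≤ h x * ((p - 1) / p) := by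
    rw [← mul_div_assoc, div_le_iff₀ hHr]
    linarith
  have h6 : h x * ((p - 1) / p) = h x - h x / p := by field_simp
  linarith

/-- The best constant `t` in `w ≤ t H` near `0` must satisfy `t ≤ 1 - (l t)^(-r)`, that is `1 ≤ l t
(1-t)^(p-1)`. This is impossible for `l` below the sharp constant. -/
theorem not_isProfile_of_le {p l δ : ℝ} {h d ρ w : ℝ → ℝ} (hp : 1 < p)
    (hh : ContinuousOn h (Icc 0 1))
    (hρ : ∀ u ∈ Ioo (0 : ℝ) 1, 0 < ρ u) (hd : ∀ u ∈ Ioo (0 : ℝ) 1, 0 < d u)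
    (hδ : δ ∈ Ioc (0 : ℝ) 1) (hl : l < p ^ p / (p - 1) ^ (p - 1))
    (hle : ∀ u ∈ Ioo 0 δ, 0 ≤ h u ∧
        h u ^ (p - 1) * (∫ s in (0 : ℝ)..u, h s) ≤ l * d u * ρ u ^ (p - 1))
    (hw : IsProfile (1 / (p - 1)) h (fun x => ρ x * d x ^ (1 / (p - 1))) w)
    (hw0 : Tendsto w (𝓝[>] 0) (𝓝 0)) : False := by
  have hp0 : 0 < p := by linarith
  have hp1 : 0 < p - 1 := by linarith
  have hK : 0 < p ^ p / (p - 1) ^ (p - 1) := by positivity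
  have hsub : Ioo 0 δ ⊆ Ioo 0 1 := Ioo_subset_Ioo_right hδ.2
  -- A nonpositive `l` may be raised to half the sharp constant; positivity is needed for the powers
  -- of `l`.
  wlog hl0 : 0 < l generalizing l
  · refine this (half_lt_self hK) (fun u hu => ⟨(hle u hu).1, (hle u hu).2.trans ?_⟩)
      (half_pos hK)
    have h1 := hd u (hsub hu)
    have h2 := hρ u (hsub hu)
    gcongr
    linarith
  set H : ℝ → ℝ := fun x => ∫ s in (0 : ℝ)..x, h s with hH
  set r := 1 / (p - 1) with hr
  have hr0 : 0 < r := by positivity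
  have hi := integrableOn_Ioo_of_continuousOn_Icc hh
  have hq : ∀ x ∈ Ioo (0 : ℝ) 1, 0 < ρ x * d x ^ r := fun x hx =>
    mul_pos (hρ x hx) (Real.rpow_pos_of_pos (hd x hx) _)
  have hwH : ∀ x ∈ Ioo (0 : ℝ) 1, w x < H x := hw.lt_primitive hh hq hw0
  have hHpos : ∀ x ∈ Ioo (0 : ℝ) 1, 0 < H x := fun x hx => (hw x hx).1.trans (hwH x hx)
  have hqle : ∀ x ∈ Ioo 0 δ, h x * H x ^ r ≤ l ^ r * (ρ x * d x ^ r) := by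
    intro x hx
    obtain ⟨h0, h1⟩ := hle x hx
    have hdx := hd x (hsub hx)
    have hρx := hρ x (hsub hx)
    have h2 := Real.rpow_le_rpow (mul_nonneg (Real.rpow_nonneg h0 _) (hHpos x (hsub hx)).le) h1
      hr0.le
    rw [hr, mul_rpow_rpow_inv hp h0 (hHpos x (hsub hx)).le, mul_comm (l * d x),
      mul_rpow_rpow_inv hp hρx.le (by positivity), Real.mul_rpow hl0.le hdx.le, ← hr] at h2
    linarith
  obtain ⟨y, hy⟩ := nonempty_Ioo.2 hδ.1
  set S : Set ℝ := {t | ∀ x ∈ Ioo 0 δ, w x ≤ t * H x} with hS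
  have hpos : ∀ t ∈ S, 0 < t := fun t ht =>
    pos_of_mul_pos_left ((hw y (hsub hy)).1.trans_le (ht y hy)) (hHpos y (hsub hy)).le
  have h1S : (1 : ℝ) ∈ S := fun x hx => by simpa using (hwH x (hsub hx)).le
  have hbd : BddBelow S := ⟨0, fun t ht => (hpos t ht).le⟩
  have hmem : sInf S ∈ S := by
    intro x hx
    have hHx := hHpos x (hsub hx)
    rw [← div_le_iff₀ hHx]
    exact le_csInf ⟨1, h1S⟩ fun t ht => (div_le_iff₀ hHx).2 (ht x hx)
  set t := sInf S with ht
  have ht0 := hpos t hmem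
  have hlt : 0 < (l * t) ^ r := Real.rpow_pos_of_pos (mul_pos hl0 ht0) r
  -- From `w ≤ t H` and `h H^r ≤ l^r q` follows `q w^(-r) ≥ h (l t)^(-r)`, so `w' ≤ (1 - (l t)^(-r))
  -- h`; integrate from `0`.
  have hnext : 1 - ((l * t) ^ r)⁻¹ ∈ S := by
    intro x hx
    have := nonneg_of_hasDerivAt_nonneg (δ := δ)
      (D := fun x => (1 - ((l * t) ^ r)⁻¹) * H x - w x)
      (fun y hy => ((hasDerivAt_primitive (hh.mono Ioo_subset_Icc_self) hi
        (hsub hy)).const_mul _).sub (hw y (hsub hy)).2) (fun y hy => ?_)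
      (by simpa using ((tendsto_primitive_zero hi).const_mul _).sub hw0) x hx
    · linarith
    have hwy := (hw y (hsub hy)).1
    have hHy := hHpos y (hsub hy)
    have hHr := Real.rpow_pos_of_pos hHy r
    have hwr := Real.rpow_pos_of_pos hwy r
    have a1 : w y ^ r ≤ t ^ r * H y ^ r := by
      rw [← Real.mul_rpow ht0.le hHy.le]
      exact Real.rpow_le_rpow hwy.le (hmem y hy) hr0.le
    have a2 : h y * ((l * t) ^ r)⁻¹ ≤ ρ y * d y ^ r * w y ^ (-r) := by
      rw [Real.rpow_neg hwy.le, ← div_eq_mul_inv, ← div_eq_mul_inv, div_le_div_iff₀ hlt hwr,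
        Real.mul_rpow hl0.le ht0.le]
      have htr := Real.rpow_nonneg ht0.le r
      calc h y * w y ^ r ≤ h y * (t ^ r * H y ^ r) :=
            mul_le_mul_of_nonneg_left a1 (hle y hy).1
        _ = (h y * H y ^ r) * t ^ r := by ring
        _ ≤ (l ^ r * (ρ y * d y ^ r)) * t ^ r := mul_le_mul_of_nonneg_right (hqle y hy) htr
        _ = ρ y * d y ^ r * (l ^ r * t ^ r) := by ring
    linarith
  have hle1 : t ≤ 1 - ((l * t) ^ r)⁻¹ := csInf_le hbd hnext
  have ht1 : t < 1 := by linarith [inv_pos.2 hlt]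
  have h1 : 1 ≤ (1 - t) * (l * t) ^ r := by
    have := mul_le_mul_of_nonneg_right (show ((l * t) ^ r)⁻¹ ≤ 1 - t by linarith) hlt.le
    rwa [inv_mul_cancel₀ hlt.ne'] at this
  have h2 := Real.one_le_rpow h1 hp1.le
  rw [Real.mul_rpow (by linarith) hlt.le, ← Real.rpow_mul (by positivity),
    show r * (p - 1) = 1 by rw [hr]; field_simp, Real.rpow_one] at h2
  have h3 := one_sub_rpow_mul_le hp ⟨ht0, ht1⟩
  have h4 : 0 < (1 - t) ^ (p - 1) * t := mul_pos (Real.rpow_pos_of_pos (by linarith) _) ht0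
  have h5 := mul_lt_mul_of_pos_right hl h4
  linarith

/-! ### The threshold and the main theorem. -/

theorem admissibleSpeed_iff_exists_isProfile {p : ℝ} {f g d ρ : ℝ → ℝ} (hp : 1 < p)
    (hf : ContinuousOn f (Icc 0 1)) (hg : ContinuousOn g (Icc 0 1))
    (hρc : ContinuousOn ρ (Icc 0 1)) (hdc : ContinuousOn d (Ioo 0 1))
    (hρ : ∀ u ∈ Ioo (0 : ℝ) 1, 0 < ρ u) (hd : ∀ u ∈ Ioo (0 : ℝ) 1, 0 < d u) (c : ℝ) :
    AdmissibleSpeed p f g d ρ c ↔ ∃ w : ℝ → ℝ,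
      IsProfile (1 / (p - 1)) (fun x => c * g x - f x)
        (fun x => ρ x * d x ^ (1 / (p - 1))) w ∧
      Tendsto w (𝓝[>] 0) (𝓝 0) ∧ Tendsto w (𝓝[<] 1) (𝓝 0) :=
  ⟨fun ⟨_, _, _, hu⟩ => hu.exists_isProfile hp hρ hd, fun ⟨_, hw, hw0, hw1⟩ =>
    admissibleSpeed_of_isProfile hp hf hg hρc hdc hd hw hw0 hw1⟩

theorem theorem4p2 (p : ℝ) (hp : 1 < p) (f g d ρ : ℝ → ℝ)
    (hf : ContinuousOn f (Icc 0 1)) (hg : ContinuousOn g (Icc 0 1))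
    (hρ : ContinuousOn ρ (Icc 0 1)) (hd : ContDiffOn ℝ 1 d (Ioo 0 1))
    (hρ_pos : ∀ u ∈ Ioo (0 : ℝ) 1, 0 < ρ u) (hρ_zero : ρ 0 = 0) (hρ_one : ρ 1 = 0)
    (hg_zero : 0 < g 0) (hg_int : ∀ u ∈ Ioc (0 : ℝ) 1, 0 < ∫ s in (0 : ℝ)..u, g s)
    (hd_pos : ∀ u ∈ Ioo (0 : ℝ) 1, 0 < d u)
    (hd_int : IntegrableOn (fun u => ρ u * d u ^ (1 / (p - 1))) (Ioo 0 1))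
    (hl : ∃ l₀ : ℝ, Tendsto (fun u => ρ u * (d u ^ (1 / (p - 1)) / u ^ (1 / (p - 1))))
      (𝓝[>] 0) (𝓝 l₀))
    (k : ℝ) :
    -- `c*` is indeed the threshold between inadmissible and admissible speeds
    (∀ c : ℝ, AdmissibleSpeed p f g d ρ c ↔ thresholdSpeed p f g d ρ ≤ c) ∧
    -- (a)
    ((∃ δ ∈ Ioc (0 : ℝ) 1, ∀ u ∈ Ioo 0 δ, k * g u ≤ f u) → k < thresholdSpeed p f g d ρ) ∧
    -- (b)
    ((∀ u ∈ Ioo (0 : ℝ) 1, f u ≤ k * g u ∧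
        p ^ p / (p - 1) ^ (p - 1) * d u * ρ u ^ (p - 1) ≤
          (k * g u - f u) ^ (p - 1) * ∫ s in (0 : ℝ)..u, (k * g s - f s)) →
      thresholdSpeed p f g d ρ ≤ k) ∧
    -- (c)
    ((∃ l : ℝ, l < p ^ p / (p - 1) ^ (p - 1) ∧ ∃ δ ∈ Ioc (0 : ℝ) 1, ∀ u ∈ Ioo 0 δ,
        f u ≤ k * g u ∧
        (k * g u - f u) ^ (p - 1) * (∫ s in (0 : ℝ)..u, (k * g s - f s)) ≤
          l * d u * ρ u ^ (p - 1)) →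
      k < thresholdSpeed p f g d ρ) := by
  have hr : 0 < 1 / (p - 1) := one_div_pos.2 (by linarith)
  have hdc := hd.continuousOn
  have hIcc : Ioo (0 : ℝ) 1 ⊆ Icc 0 1 := Ioo_subset_Icc_self
  set q : ℝ → ℝ := fun x => ρ x * d x ^ (1 / (p - 1)) with hqdef
  have hqc : ContinuousOn q (Ioo 0 1) :=
    (hρ.mono hIcc).mul (hdc.rpow_const fun x hx => Or.inl (hd_pos x hx).ne')
  have hq : ∀ x ∈ Ioo (0 : ℝ) 1, 0 < q x := fun x hx =>
    mul_pos (hρ_pos x hx) (Real.rpow_pos_of_pos (hd_pos x hx) _)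
  have hh : ∀ c : ℝ, ContinuousOn (fun x => c * g x - f x) (Icc 0 1) := fun c =>
    (continuousOn_const.mul hg).sub hf
  have hfi := integrableOn_Ioo_of_continuousOn_Icc hf
  have hgi := integrableOn_Ioo_of_continuousOn_Icc hg
  have hiff := admissibleSpeed_iff_exists_isProfile hp hf hg hρ hdc hρ_pos hd_pos
  have hsub : ∀ (c : ℝ) (v : ℝ → ℝ), IsSubprofile (1 / (p - 1)) (fun x => c * g x - f x) q v →
      Tendsto v (𝓝[>] 0) (𝓝 0) → AdmissibleSpeed p f g d ρ c := fun c v hv hv0 =>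
    (hiff c).2 (exists_isProfile_of_isSubprofile hr (hh c) hqc hq hd_int hv hv0)
  have hup : ∀ c c' : ℝ, AdmissibleSpeed p f g d ρ c → c ≤ c' → AdmissibleSpeed p f g d ρ c' := by
    intro c c' hc hcc
    obtain ⟨w, hw, hw0, -⟩ := (hiff c).1 hc
    refine hsub c' _ (IsSubprofile.of_le hr hq hw
      (E := fun x => (c' - c) * ∫ t in (0 : ℝ)..x, g t)
      (fun x hx => (hasDerivAt_primitive (hg.mono hIcc) hgi hx).const_mul _)
      (fun x hx => mul_nonneg (sub_nonneg.2 hcc) (hg_int x ⟨hx.1, hx.2.le⟩).le)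
      fun x _ => le_rfl) ?_
    simpa using hw0.add ((tendsto_primitive_zero hgi).const_mul (c' - c))
  have hne : {c : ℝ | AdmissibleSpeed p f g d ρ c}.Nonempty := by
    obtain ⟨l₀, hl₀⟩ := hl
    obtain ⟨c, v, hv, hv0⟩ := exists_isSubprofile_of_large (q := q) hr hf hg hqc hq hd_int hg_zero
      hg_int (hl₀.congr fun x => (mul_div_assoc _ _ _).symm)
    exact ⟨c, hsub c v hv hv0⟩
  have hbdd : BddBelow {c : ℝ | AdmissibleSpeed p f g d ρ c} := by
    have hG1 := hg_int 1 (by simp)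
    -- Letting `x → 1` in `0 < w x < ∫₀ˣ (c g - f)` gives `c ∫ g ≥ ∫ f` over `[0,1]`.
    refine ⟨(∫ t in (0 : ℝ)..1, f t) / ∫ t in (0 : ℝ)..1, g t, fun c hc => ?_⟩
    obtain ⟨w, hw, hw0, -⟩ := (hiff c).1 hc
    have hlt := hw.lt_primitive (hh c) hq hw0
    have hc1 := continuousOn_primitive_Ioo (integrableOn_Ioo_of_continuousOn_Icc (hh c)) 1 (by simp)
    have hnn : 0 ≤ ∫ t in (0 : ℝ)..1, (c * g t - f t) := by
      have h1 : Tendsto (fun x => ∫ t in (0 : ℝ)..x, (c * g t - f t)) (𝓝[<] 1)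
          (𝓝 (∫ t in (0 : ℝ)..1, (c * g t - f t))) := by
        rw [← nhdsWithin_Ioo_eq_nhdsLT (zero_lt_one' ℝ)]
        exact hc1.mono_left (nhdsWithin_mono _ hIcc)
      refine ge_of_tendsto h1 ?_
      filter_upwards [Ioo_mem_nhdsLT zero_lt_one] with x hx
      exact ((hw x hx).1.trans (hlt x hx)).le
    have hgI : IntervalIntegrable g volume 0 1 := by
      rwa [intervalIntegrable_iff_integrableOn_Ioo_of_le zero_le_one]
    have hfI : IntervalIntegrable f volume 0 1 := by
      rwa [intervalIntegrable_iff_integrableOn_Ioo_of_le zero_le_one]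
    rw [intervalIntegral.integral_sub (hgI.const_mul c) hfI,
      intervalIntegral.integral_const_mul] at hnn
    rw [div_le_iff₀ hG1]
    linarith
  have hmem : AdmissibleSpeed p f g d ρ (thresholdSpeed p f g d ρ) := by
    set c₀ := thresholdSpeed p f g d ρ with hc₀
    obtain ⟨M, hM⟩ := isCompact_Icc.exists_bound_of_continuousOn hg
    have hM0 : 0 ≤ M := (norm_nonneg _).trans (hM 0 (by simp))
    obtain ⟨W, hW, hW1⟩ := exists_isProfile_tendsto_one hr (hh c₀) hqc hq hd_int
    refine (hiff c₀).2 ⟨W, hW, tendsto_order.2 ⟨fun a ha => ?_, fun η hη => ?_⟩, hW1⟩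
    · filter_upwards [Ioo_mem_nhdsGT zero_lt_one] with x hx using ha.trans (hW x hx).1
    -- An admissible speed so close to `c₀` that the perturbation below costs at most `η/2`; `M + 1`
    -- avoids dividing by zero.
    obtain ⟨c, hc, hcη⟩ := (csInf_lt_iff hbdd hne).1
      (show sInf {c : ℝ | AdmissibleSpeed p f g d ρ c} < c₀ + η / 2 / (M + 1) from
        lt_add_of_pos_right _ (by positivity))
    have hcc : c₀ ≤ c := csInf_le hbdd hc
    obtain ⟨w, hw, hw0, -⟩ := (hiff c).1 hc
    -- The slope `-(c - c₀) M` compensates the lower speed. This subsolution need not vanish at `0`,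
    -- but it is below `η` near `0`, and so is `W`.
    have hv := IsSubprofile.of_le (c' := c₀) hr hq hw (E := fun x => (c - c₀) * M * (1 - x))
      (fun x hx => ((hasDerivAt_id x).const_sub 1).const_mul _)
      (fun x hx => mul_nonneg (mul_nonneg (sub_nonneg.2 hcc) hM0) (by linarith [hx.2]))
      (fun x hx => by
        have h1 := mul_le_mul_of_nonneg_left ((le_abs_self _).trans (hM x (hIcc hx)))
          (sub_nonneg.2 hcc)
        linarith)
    have hle := hW.le_of_isSubprofile hr hq hW1 hv
    have hsmall : (c - c₀) * M ≤ η / 2 := by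
      have h1 : c - c₀ ≤ η / 2 / (M + 1) := by linarith
      rw [le_div_iff₀ (by positivity)] at h1
      linarith
    filter_upwards [Ioo_mem_nhdsGT zero_lt_one,
      hw0.eventually (eventually_lt_nhds (half_pos hη))] with x hx hwx
    have h1 := hle x hx
    have h2 : (c - c₀) * M * (1 - x) ≤ (c - c₀) * M :=
      mul_le_of_le_one_right (mul_nonneg (sub_nonneg.2 hcc) hM0) (by linarith [hx.1])
    linarith
  have hthr : ∀ c : ℝ, AdmissibleSpeed p f g d ρ c ↔ thresholdSpeed p f g d ρ ≤ c := fun c =>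
    ⟨fun hc => csInf_le hbdd hc, fun hc => hup _ _ hmem hc⟩
  refine ⟨hthr, ?_, ?_, ?_⟩
  · rintro ⟨δ, hδ, hfg⟩
    rw [← not_le, ← hthr]
    intro hk
    obtain ⟨w, hw, hw0, -⟩ := (hiff k).1 hk
    have hy : δ / 2 ∈ Ioo (0 : ℝ) 1 := ⟨by linarith [hδ.1], by linarith [hδ.1, hδ.2]⟩
    have h1 := hw.lt_primitive (hh k) hq hw0 _ hy
    -- Near `0` the integrand is nonpositive, which contradicts `0 < w < ∫ (k g - f)`.
    have h2 : 0 ≤ -∫ t in (0 : ℝ)..(δ / 2), (k * g t - f t) := by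
      have hki := integrableOn_Ioo_of_continuousOn_Icc (hh k)
      exact nonneg_of_hasDerivAt_nonneg (δ := δ)
        (fun x hx => (hasDerivAt_primitive ((hh k).mono hIcc) hki
          (Ioo_subset_Ioo_right hδ.2 hx)).neg)
        (fun x hx => by linarith [hfg x hx]) (by have := (tendsto_primitive_zero hki).neg; rwa [neg_zero] at this)
        (δ / 2) ⟨by linarith [hδ.1], by linarith [hδ.1]⟩
    linarith [(hw _ hy).1]
  · intro hb
    refine csInf_le hbdd (hsub k _ (isSubprofile_of_le hp (hh k) hρ_pos hd_pos fun x hx =>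
      ⟨sub_nonneg.2 (hb x hx).1, (hb x hx).2⟩) ?_)
    simpa using (tendsto_primitive_zero
      (integrableOn_Ioo_of_continuousOn_Icc (hh k))).div_const p
  · rintro ⟨l, hlK, δ, hδ, hle⟩
    rw [← not_le, ← hthr]
    intro hk
    obtain ⟨w, hw, hw0, -⟩ := (hiff k).1 hk
    exact not_isProfile_of_le hp (hh k) hρ_pos hd_pos hδ hlK
      (fun x hx => ⟨sub_nonneg.2 (hle x hx).1, (hle x hx).2⟩) hw hw0
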